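/- **Probes.** For a point $q$ and $\omega=\pi/2$, a wedge with apex $q$ consists of two rays $H_1,H_2$ from $q$, where $H_2$ is $H_1$ turned counterclockwise by $\omega$, together with all points between them. Let $\mathcal O$ be a convex polygon (a closed region). A valid probe of $\mathcal O$ along a directed line $\overrightarrow L$ is a wedge that contains $\mathcal O$, both of whose arms meet $\mathcal O$, whose apex $q$ lies on $\overrightarrow L$, and such that the ray from $q$ in the direction of $\overrightarrow L$ meets $\mathcal O$. Its outcome is $(q,H_1,H_2,p_1,p_2)$, where $p_i$ is the point of $\mathcal O\cap H_i$ closest to $q$. We write $\overrightarrow{L_{ab}}$ for the line through $a\ne b$ directed from $a$ to $b$. The algorithm does not know $\mathcal O$ or its number of vertices; it is given a point $p\in\mathcal O$ and learns about $\mathcal O$ only through outcomes of probes. It maintains a convex polygon $Q$, given by discovered vertices, with a Boolean flag at each vertex of $Q$; $F$ denotes the number of vertices of $Q$ whose flag is false. "Add $x$" means: insert $x$ as a vertex of $Q$ in its position in convex order, with flag false. **Initialization (Input 2).** Probe along an arbitrary line $\overrightarrow L$ containing $p$, with outcome $(q,H_1,H_2,v_1,v_2)$. Then probe along $\overrightarrow{L_{v_1v_2}}$,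 with apex $q'$ and points of contact $p_1',p_2'$. * Case 1, $p_2'\neq v_1$. Put $v_3=p_1'$, $v_4=p_2'$, and let $Q$ have the vertices $v_1,v_2,v_3,v_4$, all flags false. * Case 2, $p_2'=v_1$. Put $v_4=p_1'$ and probe along $\overrightarrow{L_{v_4v_2}}$, with points of contact $v_3$ (on the first arm) and $v$ (on the second arm). Let $Q$ have the vertices $v_1,v_2,v_3,v_4$, with the flag of $v_2$ true and the others false; if $v\ne v_1$, also add $v$. **Hit step.** One further probe, with points of contact $p_1^*,p_2^*$, is made along a line chosen as follows. All angles $\angle(a,b,c)$ are angles at $b$ in $[0,\pi]$. * After Case 1, if $\angle(v_2,v_3,q')<\angle(q,v_2,v_3)$: probe along $\overrightarrow{L_{v_3v_1}}$ and add $p_1^*$; if $p_2^*=v_3$, set the flag of $v_1$ to true, otherwise add $p_2^*$. * After Case 1, if $\angle(v_2,v_3,q')\ge\angle(q,v_2,v_3)$: probe along $\overrightarrow{L_{v_2v_4}}$ and add $p_2^*$; if $p_1^*=v_2$, set the flag of $v_2$ to true, otherwise add $p_1^*$. * After Case 2: probe along $\overrightarrow{L_{v_3v_4}}$ and add $p_1^*$;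 if $p_2^*=v_3$, set the flag of $v_4$ to true, otherwise add $p_2^*$. **Loop.** While $F\neq0$: take an arbitrary vertex $u$ of $Q$ with flag false, let $v$ be its counterclockwise successor in $Q$, and probe along $\overrightarrow{L_{uv}}$, with points of contact $p_1,p_2$. If $p_1=u$, set the flag of $u$ to true, and add $p_2$ if it is not already a vertex of $Q$. If $p_2=u\neq p_1$, set the flag of $v$ to true and add $p_1$. Otherwise add $p_1$, and add $p_2$ if it is not already a vertex of $Q$. **Theorem.** Let $\mathcal O$ be a convex polygon with $n$ vertices all of whose internal angles are strictly larger than $\pi/2$, and let $p\in\mathcal O$. Then, whatever arbitrary choices are made, the algorithm above reconstructs $\mathcal O$ using at most $2n-3$ probes: every probe that it shoots has an outcome, it never gets stuck before it stops, it stops after at most $2n-3$ probes in total, and when it stops, the vertices of $Q$ are exactly the vertices of $\mathcal O$, so that $Q=\mathcal O$. -/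

import Mathlib

/-! Probing a convex polygon with an `ω`-wedge.  The Euclidean plane is `ℂ`. -/

noncomputable section

namespace WedgeProbing

/-! ### Convex polygons -/

/-- The planar cross product; it is positive iff `b` points to the left of `a`. -/
def cross (a b : ℂ) : ℝ := a.re * b.im - a.im * b.re

/-- `P` is a (strictly) convex polygon whose vertices are listed counterclockwise: every vertex
other than the two ends of an edge lies strictly to the left of that edge. -/
def IsConvexPolygon {n : ℕ} [NeZero n] (P : Polygon ℂ n) : Prop :=
  3 ≤ n ∧ ∀ i j : Fin n, j ≠ i → j ≠ i + 1 → 0 < cross (P (i + 1) - P i) (P j - P i)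

/-- The internal angle of a convex polygon at its `i`-th vertex. -/
def internalAngle {n : ℕ} [NeZero n] (P : Polygon ℂ n) (i : Fin n) : ℝ :=
  EuclideanGeometry.angle (P (i + 1)) (P i) (P (i - 1))

/-- The closed region bounded by a convex polygon. -/
def region {n : ℕ} (P : Polygon ℂ n) : Set ℂ := convexHull ℝ (Set.range P.vertices)

/-! ### Wedges, directed lines, and probes -/

/-- The position of a wedge: its apex and the unit direction of its first arm `H₁`.  The second
arm `H₂` is `H₁` turned counterclockwise about the apex by `ω`, so that `(q, H₁, H₂)` is a
left turn. -/
structure Wedge where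
  apex : ℂ
  dir : ℂ
  norm_dir : ‖dir‖ = 1

/-- The direction of the second arm. -/
def Wedge.dir₂ (W : Wedge) (ω : ℝ) : ℂ := Complex.exp (ω * Complex.I) * W.dir

/-- The first arm `H₁`. -/
def Wedge.arm₁ (W : Wedge) : Set ℂ :=
  {x | ∃ t : ℝ, 0 ≤ t ∧ x = W.apex + t * W.dir}

/-- The second arm `H₂`. -/
def Wedge.arm₂ (W : Wedge) (ω : ℝ) : Set ℂ :=
  {x | ∃ t : ℝ, 0 ≤ t ∧ x = W.apex + t * W.dir₂ ω}

/-- The `ω`-wedge (for `0 < ω < π`): the arms together with the points between them. -/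
def Wedge.carrier (W : Wedge) (ω : ℝ) : Set ℂ :=
  {x | ∃ s t : ℝ, 0 ≤ s ∧ 0 ≤ t ∧ x = W.apex + s * W.dir + t * W.dir₂ ω}

/-- A valid `ω`-probe of `O`: the wedge contains `O` and both arms meet `O`. -/
def IsValidProbe (ω : ℝ) (O : Set ℂ) (W : Wedge) : Prop :=
  O ⊆ W.carrier ω ∧ (O ∩ W.arm₁).Nonempty ∧ (O ∩ W.arm₂ ω).Nonempty

/-- A directed line, given by one of its points and a direction. -/
structure DirectedLine where
  point : ℂ
  dir : ℂ
  dir_ne_zero : dir ≠ 0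

/-- The points of a directed line. -/
def DirectedLine.carrier (L : DirectedLine) : Set ℂ :=
  {x | ∃ t : ℝ, x = L.point + t * L.dir}

/-- The line through `a` and `b`, directed from `a` to `b`. -/
def DirectedLine.through (a b : ℂ) (h : a ≠ b) : DirectedLine :=
  ⟨a, b - a, sub_ne_zero.mpr h.symm⟩

/-- A valid `ω`-probe of `O` with respect to `L`: the apex is on `L`, and the ray from the apex in
the direction of `L` meets `O`. -/
def IsValidProbeAlong (ω : ℝ) (O : Set ℂ) (L : DirectedLine) (W : Wedge) : Prop :=
  IsValidProbe ω O W ∧ W.apex ∈ L.carrier ∧ ∃ t : ℝ, 0 ≤ t ∧ W.apex + t * L.dir ∈ O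

/-- What a probe returns: the apex and the arms (as a wedge) and the points of contact. -/
structure Outcome where
  wedge : Wedge
  p₁ : ℂ
  p₂ : ℂ

/-- The apex of the returned wedge. -/
abbrev Outcome.apex (o : Outcome) : ℂ := o.wedge.apex

/-- `x` is a point of `S` that is closest to `q`. -/
def IsClosestIn (S : Set ℂ) (q x : ℂ) : Prop := x ∈ S ∧ ∀ y ∈ S, dist q x ≤ dist q y

/-- `o` is an outcome of probing `O` with an `ω`-wedge along `L`. -/
def IsOutcome (ω : ℝ) (O : Set ℂ) (L : DirectedLine) (o : Outcome) : Prop :=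
  IsValidProbeAlong ω O L o.wedge ∧
    IsClosestIn (O ∩ o.wedge.arm₁) o.apex o.p₁ ∧
    IsClosestIn (O ∩ o.wedge.arm₂ ω) o.apex o.p₂

/-! ### The polygon `Q` kept by the algorithm -/

/-- The polygon `Q` of discovered vertices, with a Boolean flag for each vertex.  A convex polygon
is determined by its set of vertices, and that set also determines their cyclic order (see
`IsCCWSucc`), so inserting a new vertex at its place in convex position, or passing to the convex
hull of `Q` and that vertex, is inserting it into the set.  The values of `flag` at points that
are not vertices of `Q` are irrelevant. -/
structure FlaggedPolygon where
  verts : Finset ℂ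
  flag : ℂ → Bool

namespace FlaggedPolygon

/-- The number of vertices whose flag is `false`. -/
def F (Q : FlaggedPolygon) : ℕ := (Q.verts.filter fun u => Q.flag u = false).card

/-- Add the vertex `x`, with flag `false`. -/
def add (Q : FlaggedPolygon) (x : ℂ) : FlaggedPolygon :=
  ⟨insert x Q.verts, Function.update Q.flag x false⟩

/-- Add the vertex `x`, with flag `false`, unless it is already there. -/
def addIfNew (Q : FlaggedPolygon) (x : ℂ) : FlaggedPolygon :=
  if x ∈ Q.verts then Q else Q.add x

/-- Set the flag of `u` to `true`. -/
def confirm (Q : FlaggedPolygon) (u : ℂ) : FlaggedPolygon :=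
  ⟨Q.verts, Function.update Q.flag u true⟩

/-- The polygon on the given vertices, with all flags `false`. -/
def ofVerts (V : Finset ℂ) : FlaggedPolygon := ⟨V, fun _ => false⟩

/-- `v` is the counterclockwise successor of `u` in `Q`: all other vertices lie to the left of the
line from `u` to `v`. -/
structure IsCCWSucc (Q : FlaggedPolygon) (u v : ℂ) : Prop where
  left_mem : u ∈ Q.verts
  right_mem : v ∈ Q.verts
  ne : u ≠ v
  left_of : ∀ w ∈ Q.verts, w ≠ u → w ≠ v → 0 < cross (v - u) (w - u)

end FlaggedPolygon

/-! ### The algorithm on Input 2 -/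

/-- The control states, with the data remembered in each of them. -/
inductive State where
  /-- no probe has been made -/
  | start
  /-- after the first probe -/
  | afterFirst (o : Outcome)
  /-- Case 2 of the initialization: after the second probe, the third one is due -/
  | needThird (v₁ v₂ v₄ : ℂ)
  /-- Case 1 of the initialization is complete, the hit step is due -/
  | hitCase1 (q q' v₁ v₂ v₃ v₄ : ℂ) (Q : FlaggedPolygon)
  /-- Case 2 of the initialization is complete, the hit step is due -/
  | hitCase2 (v₃ v₄ : ℂ) (Q : FlaggedPolygon)
  /-- the while loop -/
  | loop (Q : FlaggedPolygon)

/-- After the second probe of the initialization. -/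
def afterSecond (o o' : Outcome) : State :=
  if o'.p₂ = o.p₁ then .needThird o.p₁ o.p₂ o'.p₁
  else .hitCase1 o.apex o'.apex o.p₁ o.p₂ o'.p₁ o'.p₂
    (.ofVerts {o.p₁, o.p₂, o'.p₁, o'.p₂})

/-- After the third probe of the initialization, which returns `v₃` and `v`. -/
def afterThird (v₁ v₂ v₄ : ℂ) (o : Outcome) : State :=
  let v₃ := o.p₁
  let v := o.p₂
  let Q := (FlaggedPolygon.ofVerts {v₁, v₂, v₃, v₄}).confirm v₂
  .hitCase2 v₃ v₄ (if v = v₁ then Q else Q.add v)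

/-- After a hit probe along the line from `v₃` to `v₁`. -/
def afterHit31 (v₁ v₃ : ℂ) (Q : FlaggedPolygon) (o : Outcome) : State :=
  if o.p₂ = v₃ then .loop ((Q.add o.p₁).confirm v₁) else .loop ((Q.add o.p₁).add o.p₂)

/-- After a hit probe along the line from `v₂` to `v₄`. -/
def afterHit24 (v₂ : ℂ) (Q : FlaggedPolygon) (o : Outcome) : State :=
  if o.p₁ = v₂ then .loop ((Q.add o.p₂).confirm v₂) else .loop ((Q.add o.p₂).add o.p₁)

/-- After a hit probe along the line from `v₃` to `v₄`. -/
def afterHit34 (v₃ v₄ : ℂ) (Q : FlaggedPolygon) (o : Outcome) : State :=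
  if o.p₂ = v₃ then .loop ((Q.add o.p₁).confirm v₄) else .loop ((Q.add o.p₁).add o.p₂)

/-- After an iteration of the loop that probed along the line from `u` to its counterclockwise
successor `v`. -/
def afterLoop (Q : FlaggedPolygon) (u v : ℂ) (o : Outcome) : State :=
  if o.p₁ = u then .loop ((Q.confirm u).addIfNew o.p₂)
  else if o.p₂ = u then .loop ((Q.confirm v).add o.p₁)
  else .loop ((Q.add o.p₁).addIfNew o.p₂)

/-- `Move p s L next`: in state `s` the algorithm, which knows the point `p`, may shoot a probe
along `L`, and it passes to the state `next o` when the outcome of that probe is `o`.  The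
arbitrary choices of the algorithm (the first line, and the vertex `u` in each iteration of the
loop) are left open.  The loop is left, and so no move is possible, when no flag is `false`. -/
inductive Move (p : ℂ) : State → DirectedLine → (Outcome → State) → Prop where
  | first (L : DirectedLine) (hL : p ∈ L.carrier) :
      Move p .start L .afterFirst
  | second (o : Outcome) (h : o.p₁ ≠ o.p₂) :
      Move p (.afterFirst o) (.through o.p₁ o.p₂ h) (afterSecond o)
  | third (v₁ v₂ v₄ : ℂ) (h : v₄ ≠ v₂) :
      Move p (.needThird v₁ v₂ v₄) (.through v₄ v₂ h) (afterThird v₁ v₂ v₄)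
  | hit31 (q q' v₁ v₂ v₃ v₄ : ℂ) (Q : FlaggedPolygon) (h : v₃ ≠ v₁)
      (hlt : EuclideanGeometry.angle v₂ v₃ q' < EuclideanGeometry.angle q v₂ v₃) :
      Move p (.hitCase1 q q' v₁ v₂ v₃ v₄ Q) (.through v₃ v₁ h) (afterHit31 v₁ v₃ Q)
  | hit24 (q q' v₁ v₂ v₃ v₄ : ℂ) (Q : FlaggedPolygon) (h : v₂ ≠ v₄)
      (hge : EuclideanGeometry.angle q v₂ v₃ ≤ EuclideanGeometry.angle v₂ v₃ q') :
      Move p (.hitCase1 q q' v₁ v₂ v₃ v₄ Q) (.through v₂ v₄ h) (afterHit24 v₂ Q)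
  | hit34 (v₃ v₄ : ℂ) (Q : FlaggedPolygon) (h : v₃ ≠ v₄) :
      Move p (.hitCase2 v₃ v₄ Q) (.through v₃ v₄ h) (afterHit34 v₃ v₄ Q)
  | iterate (Q : FlaggedPolygon) (u v : ℂ) (hu : Q.flag u = false) (hv : Q.IsCCWSucc u v) :
      Move p (.loop Q) (.through u v hv.ne) (afterLoop Q u v)

/-- `Run ω O p k s`: on the hidden polygon `O`, some run of the algorithm is in state `s` after
exactly `k` probes. -/
inductive Run (ω : ℝ) (O : Set ℂ) (p : ℂ) : ℕ → State → Prop where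
  | start : Run ω O p 0 .start
  | probe {k : ℕ} {s : State} {L : DirectedLine} {next : Outcome → State} {o : Outcome}
      (hs : Run ω O p k s) (hm : Move p s L next) (ho : IsOutcome ω O L o) :
      Run ω O p (k + 1) (next o)

/-- The algorithm has stopped in state `s` with the polygon `Q`. -/
def HaltedWith (s : State) (Q : FlaggedPolygon) : Prop := s = .loop Q ∧ Q.F = 0

end WedgeProbing

end

/-!
The proof rests on two facts about the vertices of the hidden polygon: no vertex lies in the convex
hull of the others, and the inner normals of two lines supporting the polygon at the same vertex
form an acute angle (`ObtuseVertexSet.dot_normals_pos`), because the internal angles are obtuse.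
In particular the apex of a probe is never in the polygon, and its two points of contact are
distinct vertices (`ObtuseVertexSet.touch`).

A probe along the line from a vertex `a` to a vertex `b` finds a vertex strictly to the right of
the line and one strictly to the left, except that an arm lying on the line returns `a`, in which
case the line supports the polygon (`ObtuseVertexSet.along`).  So every iteration of the loop
discovers a new vertex to the right of `uv` or confirms that `uv` is an edge
(`invariant_afterLoop`).  Let the score of `Q` be the number of its vertices plus the number of its
confirmed vertices.  It grows by at least one with every probe of the loop and is at most `2 * n`,
so the bound `2 * n - 3` says that the score exceeds the number of probes by at least `3` when the
loop is entered.

This is the case if the hit step raises the score by two, starting from `4` after two probes or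
from at least `5` after three.  One of its points of contact confirms an edge or is a new vertex by
the previous paragraph.  The other one is on the side of the line where vertices are already known,
and it has to be shown that it is not one of them.  The directions of the first arms of consecutive
probes are compared through the signs of dot and cross products; an old vertex touched again would
have two inner normals at an angle of at least `π / 2`
(`ObtuseVertexSet.hit31`, `ObtuseVertexSet.hit24`, `ObtuseVertexSet.hit34`).  With obtuse internal
angles this works for both of the lines between which the algorithm chooses in its first case.

A probe along a line that meets the polygon exists by the intermediate value theorem, applied to
the apex of the circumscribed right-angled wedge while its direction turns by `π / 2`
(`exists_isOutcome`).  When all vertices of `Q` are confirmed, `Q` is closed under passing to the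
next vertex of the polygon, hence is the polygon (`Sound.verts_eq`).
-/

namespace WedgeProbing

open Complex

/-! ### Plane vectors -/

/-- The inner product of the plane, in coordinates. -/
def dot (a b : ℂ) : ℝ := a.re * b.re + a.im * b.im

lemma dot_self_pos {a : ℂ} (h : a ≠ 0) : 0 < dot a a := by
  have := Complex.normSq_pos.2 h
  rwa [Complex.normSq_apply] at this

lemma ne_zero_of_dot_self {a : ℂ} (h : dot a a = 1) : a ≠ 0 := by
  rintro rfl
  simp [dot] at h

lemma dot_self_of_norm {a : ℂ} (h : ‖a‖ = 1) : dot a a = 1 := by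
  have := Complex.normSq_eq_norm_sq a
  rw [h, Complex.normSq_apply] at this
  simpa [dot] using this

lemma dot_comm (a b : ℂ) : dot a b = dot b a := by simp only [dot]; ring

lemma cross_comm (a b : ℂ) : cross a b = -cross b a := by simp only [cross]; ring

lemma cross_self (a : ℂ) : cross a a = 0 := by simp only [cross]; ring

lemma cross_eq_dot (c x : ℂ) : cross c x = dot (I * c) x := by
  simp [cross, dot]; ring

/-- The inner product in the orthonormal frame of a unit vector. -/
lemma dot_frame {d : ℂ} (hd : dot d d = 1) (x y : ℂ) :
    dot x y = dot d x * dot d y + cross d x * cross d y := by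
  rw [← one_mul (dot x y), ← hd]; simp only [dot, cross]; ring

/-- The cross product in the orthonormal frame of a unit vector. -/
lemma cross_frame {d : ℂ} (hd : dot d d = 1) (x y : ℂ) :
    cross x y = dot d x * cross d y - cross d x * dot d y := by
  rw [← one_mul (cross x y), ← hd]; simp only [dot, cross]; ring

/-! ### Vertex sets of convex polygons with obtuse angles -/

/-- What the proof uses of the vertex set of a convex polygon with obtuse internal angles: each
vertex has a line meeting the polygon in that vertex only, and each vertex sees two others under an
angle that is obtuse and not straight. -/
structure ObtuseVertexSet (V : Finset ℂ) : Prop where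
  extreme : ∀ v ∈ V, ∃ f, ∀ x ∈ V, x ≠ v → 0 < cross f (x - v)
  obtuse : ∀ v ∈ V, ∃ x ∈ V, ∃ y ∈ V, dot (x - v) (y - v) < 0 ∧ cross (x - v) (y - v) ≠ 0

variable {V : Finset ℂ}

/-- The inner normals of two lines supporting the polygon at the same vertex form an acute angle:
otherwise the two half planes meet in a cone of angle at most `π / 2`. -/
lemma ObtuseVertexSet.dot_normals_pos (hV : ObtuseVertexSet V) {v a b : ℂ} (hv : v ∈ V)
    (ha : a ≠ 0) (hb : b ≠ 0) (hav : ∀ x ∈ V, 0 ≤ dot a (x - v))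
    (hbv : ∀ x ∈ V, 0 ≤ dot b (x - v)) : 0 < dot a b := by
  by_contra! hab
  obtain ⟨x, hx, y, hy, hdot, hcross⟩ := hV.obtuse v hv
  have hax := hav x hx
  have hay := hav y hy
  have hbx := hbv x hx
  have hby := hbv y hy
  set X := x - v
  set Y := y - v
  have ha' := dot_self_pos ha
  have hb' := dot_self_pos hb
  have key : cross a b ^ 2 * dot X Y = dot a X * dot a Y * dot b b + dot b X * dot b Y * dot a a
      + (dot a X * dot b Y + dot b X * dot a Y) * (-dot a b) := by
    simp only [dot, cross]; ring
  have hnn : 0 ≤ cross a b ^ 2 * dot X Y := by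
    rw [key]
    have : 0 ≤ -dot a b := by linarith
    positivity
  rcases eq_or_ne (cross a b) 0 with h0 | h0
  · -- The two lines are parallel, so the whole polygon would lie on one line.
    have hsq : dot a b ^ 2 = dot a a * dot b b := by
      have : dot a b ^ 2 + cross a b ^ 2 = dot a a * dot b b := by simp only [dot, cross]; ring
      simpa [h0] using this
    have hlt : dot a b < 0 := by
      refine lt_of_le_of_ne hab fun h => ?_
      rw [h] at hsq
      have := mul_pos ha' hb'
      simp at hsq
      rcases hsq with h | h <;> simp [h] at this
    have hz : ∀ Z, 0 ≤ dot a Z → 0 ≤ dot b Z → dot a Z = 0 := by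
      intro Z h1 h2
      have e : dot a a * dot b Z = dot a b * dot a Z + cross a b * cross a Z := by
        simp only [dot, cross]; ring
      rw [h0, zero_mul, add_zero] at e
      have := mul_nonneg ha'.le h2
      nlinarith
    have e : dot a a * cross X Y = dot a X * cross a Y - cross a X * dot a Y := by
      simp only [dot, cross]; ring
    rw [hz X hax hbx, hz Y hay hby] at e
    simp at e
    rcases e with e | e
    · exact ha'.ne' e
    · exact hcross e
  · have : 0 < cross a b ^ 2 := by positivity
    nlinarith

/-- A vertex touched by the second arm of a probe with direction `d` and by the first arm of a
probe with direction `e`: then `e` is clockwise of `d`. -/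
lemma ObtuseVertexSet.cross_neg (hV : ObtuseVertexSet V) {v d e : ℂ} (hv : v ∈ V)
    (hd : d ≠ 0) (he : e ≠ 0) (hdv : ∀ x ∈ V, 0 ≤ dot d (x - v))
    (hev : ∀ x ∈ V, 0 ≤ cross e (x - v)) : cross d e < 0 := by
  have h := hV.dot_normals_pos hv hd (mul_ne_zero I_ne_zero he) hdv
    (fun x hx => by rw [← cross_eq_dot]; exact hev x hx)
  rw [dot_comm, ← cross_eq_dot, cross_comm] at h
  linarith

/-- No three vertices are collinear: the middle one would not be extreme. -/
lemma ObtuseVertexSet.cross_ne_zero (hV : ObtuseVertexSet V) {a b c : ℂ} (ha : a ∈ V) (hb : b ∈ V)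
    (hc : c ∈ V) (hab : a ≠ b) (hac : a ≠ c) (hbc : b ≠ c) : cross (b - a) (c - a) ≠ 0 := by
  intro h0
  obtain ⟨f, hf⟩ := hV.extreme a ha
  obtain ⟨g, hg⟩ := hV.extreme b hb
  obtain ⟨k, hk⟩ := hV.extreme c hc
  have hN := dot_self_pos (sub_ne_zero.2 hab.symm)
  have key : ∀ f, dot (b - a) (b - a) * cross f (c - a)
      = dot (b - a) (c - a) * cross f (b - a) := by
    intro f
    have : dot (b - a) (b - a) * cross f (c - a) = dot (b - a) (c - a) * cross f (b - a)
      + cross (b - a) (c - a) * dot f (b - a) := by simp only [dot, cross]; ring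
    rw [this, h0]; ring
  have sub₁ : ∀ f x y : ℂ, cross f (x - y) = cross f (x - a) - cross f (y - a) := by
    intro f x y; simp only [cross, sub_re, sub_im]; ring
  have zero : ∀ f : ℂ, cross f (a - a) = 0 := by intro f; simp [cross]
  have f1 := hf b hb hab.symm
  have f2 := hf c hc hac.symm
  have g1 := hg a ha hab
  have g2 := hg c hc hbc.symm
  have k1 := hk a ha hac
  have k2 := hk b hb hbc
  rw [sub₁, zero] at g1 k1
  rw [sub₁] at g2 k2
  have kf := key f
  have kg := key g
  have kk := key k
  set N := dot (b - a) (b - a)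
  set D := dot (b - a) (c - a)
  have hD : 0 < D := by
    by_contra! h
    have := mul_pos hN f2
    nlinarith
  have hDN : D < N := by
    by_contra! h
    have := mul_pos hN g2
    nlinarith
  have hk3 := mul_pos hN k2
  have hk4 := mul_pos hN k1
  nlinarith

/-- A vertex does not lie in the triangle of three others, so if the diagonal `ac` separates `b`
from `e`, then `a, b, c, e` are in this cyclic order. -/
lemma ObtuseVertexSet.cross_pos_of_separated (hV : ObtuseVertexSet V) {a b c e : ℂ} (ha : a ∈ V)
    (hb : b ∈ V) (hc : c ∈ V) (he : e ∈ V) (hbr : cross (c - a) (b - a) < 0)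
    (hel : 0 < cross (c - a) (e - a)) : 0 < cross (b - a) (e - a) := by
  by_contra! h
  obtain ⟨f, hf⟩ := hV.extreme a ha
  have hca : c ≠ a := by rintro rfl; simp [cross] at hel
  have hba : b ≠ a := by rintro rfl; simp [cross] at hbr
  have hea : e ≠ a := by rintro rfl; simp [cross] at hel
  have fb := hf b hb hba
  have fc := hf c hc hca
  have fe := hf e he hea
  -- the barycentric coordinates of `a` in the triangle `b c e`
  have id₁ : cross (c - a) (e - a) * cross f (b - a) + (-cross (b - a) (e - a)) * cross f (c - a)
      + (-cross (c - a) (b - a)) * cross f (e - a) = 0 := by simp only [cross]; ring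
  have := mul_pos hel fb
  have := mul_nonneg (neg_nonneg.2 h) fc.le
  have := mul_pos (neg_pos.2 hbr) fe
  linarith

lemma cross_rotate (a b c : ℂ) : cross (b - a) (c - a) = cross (c - b) (a - b) := by
  simp only [cross, sub_re, sub_im]; ring

lemma cross_swap (a b c : ℂ) : cross (b - a) (c - a) = -cross (a - b) (c - b) := by
  simp only [cross, sub_re, sub_im]; ring

/-! ### What the outcome of a probe says about the vertices -/

/-- The vertices `p₁` and `p₂` are the points of contact of a probe whose first arm has the unit
direction `d`. -/
structure Touch (V : Finset ℂ) (d p₁ p₂ : ℂ) : Prop where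
  unit : dot d d = 1
  mem₁ : p₁ ∈ V
  mem₂ : p₂ ∈ V
  right : ∀ x ∈ V, 0 ≤ cross d (x - p₁)
  left : ∀ x ∈ V, 0 ≤ dot d (x - p₂)
  right_min : ∀ x ∈ V, cross d (x - p₁) = 0 → 0 ≤ dot d (x - p₁)
  left_min : ∀ x ∈ V, dot d (x - p₂) = 0 → 0 ≤ cross d (x - p₂)
  dot_pos : 0 < dot d (p₁ - p₂)
  cross_pos : 0 < cross d (p₂ - p₁)

/-- How the points of contact of a probe along the line from the vertex `a` to the vertex `b` lie
with respect to that line: each is strictly on its side of the line, unless its arm lies on the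
line; then it is `a`, and the line supports the polygon. -/
structure Along (V : Finset ℂ) (d p₁ p₂ a b : ℂ) : Prop where
  dot_nonneg : 0 ≤ dot d (b - a)
  cross_nonneg : 0 ≤ cross d (b - a)
  right : (cross (b - a) (p₁ - a) < 0 ∧ 0 < cross d (b - a)) ∨
    (p₁ = a ∧ cross d (b - a) = 0 ∧ ∀ x ∈ V, 0 ≤ cross (b - a) (x - a))
  left : (0 < cross (b - a) (p₂ - a) ∧ 0 < dot d (b - a)) ∨
    (p₂ = a ∧ dot d (b - a) = 0 ∧ ∀ x ∈ V, cross (b - a) (x - a) ≤ 0)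

lemma Touch.dir_ne_zero {d p₁ p₂ : ℂ} (h : Touch V d p₁ p₂) : d ≠ 0 := ne_zero_of_dot_self h.unit

lemma Wedge.dot_dir (W : Wedge) : dot W.dir W.dir = 1 := dot_self_of_norm W.norm_dir

lemma Wedge.dir₂_pi_div_two (W : Wedge) : W.dir₂ (Real.pi / 2) = I * W.dir := by
  rw [Wedge.dir₂]
  congr 1
  push_cast
  exact Complex.exp_pi_div_two_mul_I

/-- The coordinates of a vector in the frame of a unit vector. -/
lemma eq_frame {d : ℂ} (hd : dot d d = 1) (z : ℂ) :
    z = (dot d z : ℂ) * d + (cross d z : ℂ) * (I * d) := by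
  apply Complex.ext
  · simp [dot, cross] at *
    linear_combination (-z.re) * hd
  · simp [dot, cross] at *
    linear_combination (-z.im) * hd

lemma eq_of_frame {d : ℂ} (hd : dot d d = 1) {z w : ℂ} (h₁ : dot d z = dot d w)
    (h₂ : cross d z = cross d w) : z = w := by
  rw [eq_frame hd z, h₁, h₂, ← eq_frame hd w]

lemma dot_combo {d : ℂ} (hd : dot d d = 1) (s t : ℝ) :
    dot d (s * d + t * (I * d)) = s := by
  simp [dot] at *
  linear_combination s * hd

lemma cross_combo {d : ℂ} (hd : dot d d = 1) (s t : ℝ) :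
    cross d (s * d + t * (I * d)) = t := by
  simp [dot, cross] at *
  linear_combination t * hd

lemma Wedge.mem_carrier_iff (W : Wedge) (x : ℂ) : x ∈ W.carrier (Real.pi / 2) ↔
    0 ≤ dot W.dir (x - W.apex) ∧ 0 ≤ cross W.dir (x - W.apex) := by
  constructor
  · rintro ⟨s, t, hs, ht, rfl⟩
    rw [W.dir₂_pi_div_two, show W.apex + s * W.dir + t * (I * W.dir) - W.apex
      = s * W.dir + t * (I * W.dir) by ring, dot_combo W.dot_dir, cross_combo W.dot_dir]
    exact ⟨hs, ht⟩
  · rintro ⟨hs, ht⟩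
    refine ⟨_, _, hs, ht, ?_⟩
    rw [W.dir₂_pi_div_two, add_assoc, ← eq_frame W.dot_dir]; ring

lemma Wedge.mem_arm₁_iff (W : Wedge) (x : ℂ) : x ∈ W.arm₁ ↔
    0 ≤ dot W.dir (x - W.apex) ∧ cross W.dir (x - W.apex) = 0 := by
  constructor
  · rintro ⟨s, hs, rfl⟩
    rw [show W.apex + s * W.dir - W.apex = s * W.dir + (0 : ℝ) * (I * W.dir) by simp,
      dot_combo W.dot_dir, cross_combo W.dot_dir]
    exact ⟨hs, rfl⟩
  · rintro ⟨hs, ht⟩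
    refine ⟨_, hs, ?_⟩
    have := eq_frame W.dot_dir (x - W.apex)
    rw [ht, ofReal_zero, zero_mul, add_zero] at this
    rw [← this]; ring

lemma Wedge.mem_arm₂_iff (W : Wedge) (x : ℂ) : x ∈ W.arm₂ (Real.pi / 2) ↔
    dot W.dir (x - W.apex) = 0 ∧ 0 ≤ cross W.dir (x - W.apex) := by
  constructor
  · rintro ⟨s, hs, rfl⟩
    rw [W.dir₂_pi_div_two, show W.apex + s * (I * W.dir) - W.apex
      = (0 : ℝ) * W.dir + s * (I * W.dir) by simp, dot_combo W.dot_dir, cross_combo W.dot_dir]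
    exact ⟨rfl, hs⟩
  · rintro ⟨hs, ht⟩
    refine ⟨_, ht, ?_⟩
    have := eq_frame W.dot_dir (x - W.apex)
    rw [hs, ofReal_zero, zero_mul, zero_add] at this
    rw [W.dir₂_pi_div_two, ← this]; ring

lemma dist_eq_frame {d : ℂ} (hd : dot d d = 1) (q x : ℂ) :
    dist q x ^ 2 = dot d (x - q) ^ 2 + cross d (x - q) ^ 2 := by
  rw [dist_comm, dist_eq_norm, ← Complex.normSq_eq_norm_sq, Complex.normSq_apply]
  have := dot_frame hd (x - q) (x - q)
  simp only [dot] at this ⊢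
  linear_combination this

/-- A minimizer over the convex hull of `V` of one linear functional, ties being broken by another
one that is injective together with the first, is a point of `V`. -/
lemma mem_of_lex_min {a b z : ℂ} (hz : z ∈ convexHull ℝ (V : Set ℂ))
    (hab : ∀ w, dot a w = 0 → dot b w = 0 → w = 0)
    (ha : ∀ x ∈ V, 0 ≤ dot a (x - z)) (hb : ∀ x ∈ V, dot a (x - z) = 0 → 0 ≤ dot b (x - z)) :
    z ∈ V := by
  rw [Finset.mem_convexHull'] at hz
  obtain ⟨w, hw0, hw1, hwz⟩ := hz
  have hsum : ∀ c : ℂ, ∑ y ∈ V, w y * dot c (y - z) = 0 := by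
    intro c
    have h1 : ∑ y ∈ V, w y * dot c (y - z) = dot c (∑ y ∈ V, w y • y - (∑ y ∈ V, w y) • z) := by
      simp only [dot, sub_re, sub_im, re_sum, im_sum, real_smul, re_ofReal_mul, im_ofReal_mul,
        Finset.mul_sum, Finset.sum_mul, ← Finset.sum_sub_distrib, ← Finset.sum_add_distrib]
      exact Finset.sum_congr rfl fun y _ => by ring
    rw [h1, hwz, hw1]; simp [dot]
  have hA := (Finset.sum_eq_zero_iff_of_nonneg
    (fun y hy => mul_nonneg (hw0 y hy) (ha y hy))).1 (hsum a)
  have hB := (Finset.sum_eq_zero_iff_of_nonneg (fun y hy => by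
    rcases mul_eq_zero.1 (hA y hy) with h | h
    · simp [h]
    · exact mul_nonneg (hw0 y hy) (hb y hy h))).1 (hsum b)
  obtain ⟨y, hy, hwy⟩ : ∃ y ∈ V, w y ≠ 0 := by
    by_contra! h
    rw [Finset.sum_eq_zero h] at hw1
    exact zero_ne_one hw1
  have := hab _ ((mul_eq_zero.1 (hA y hy)).resolve_left hwy)
    ((mul_eq_zero.1 (hB y hy)).resolve_left hwy)
  rwa [← sub_eq_zero.1 this]

/-- The apex of a probe is not in the polygon, and the points of contact are vertices. -/
lemma ObtuseVertexSet.touch (hV : ObtuseVertexSet V) {L : DirectedLine} {o : Outcome}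
    (ho : IsOutcome (Real.pi / 2) (convexHull ℝ (V : Set ℂ)) L o) :
    Touch V o.wedge.dir o.p₁ o.p₂ ∧
      0 < dot o.wedge.dir (o.p₁ - o.apex) ∧ cross o.wedge.dir (o.p₁ - o.apex) = 0 ∧
      dot o.wedge.dir (o.p₂ - o.apex) = 0 ∧ 0 < cross o.wedge.dir (o.p₂ - o.apex) ∧
      o.apex ∉ convexHull ℝ (V : Set ℂ) := by
  obtain ⟨⟨⟨hsub, -, -⟩, -, -⟩, ⟨⟨hp₁, ha₁⟩, hm₁⟩, ⟨hp₂, ha₂⟩, hm₂⟩ := ho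
  set d := o.wedge.dir
  set q := o.apex
  have hd : dot d d = 1 := o.wedge.dot_dir
  have hin : ∀ x ∈ V, x ∈ convexHull ℝ (V : Set ℂ) := fun x hx => subset_convexHull _ _ hx
  have hW : ∀ x ∈ V, 0 ≤ dot d (x - q) ∧ 0 ≤ cross d (x - q) := fun x hx =>
    (o.wedge.mem_carrier_iff x).1 (hsub (hin x hx))
  obtain ⟨hs, hs0⟩ := (o.wedge.mem_arm₁_iff _).1 ha₁
  obtain ⟨ht0, ht⟩ := (o.wedge.mem_arm₂_iff _).1 ha₂
  have dsub : ∀ x y, dot d (x - y) = dot d (x - q) - dot d (y - q) := by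
    intro x y; simp only [dot, sub_re, sub_im]; ring
  have csub : ∀ x y, cross d (x - y) = cross d (x - q) - cross d (y - q) := by
    intro x y; simp only [cross, sub_re, sub_im]; ring
  have R : ∀ x ∈ V, 0 ≤ cross d (x - o.p₁) := fun x hx => by
    rw [csub, hs0, sub_zero]; exact (hW x hx).2
  have Lf : ∀ x ∈ V, 0 ≤ dot d (x - o.p₂) := fun x hx => by
    rw [dsub, ht0, sub_zero]; exact (hW x hx).1
  have R' : ∀ x ∈ V, cross d (x - o.p₁) = 0 → 0 ≤ dot d (x - o.p₁) := by
    intro x hx h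
    rw [csub, hs0, sub_zero] at h
    have h1 := hm₁ x ⟨hin x hx, (o.wedge.mem_arm₁_iff _).2 ⟨(hW x hx).1, h⟩⟩
    have h2 := pow_le_pow_left₀ dist_nonneg h1 2
    rw [dist_eq_frame hd, dist_eq_frame hd, hs0, h] at h2
    rw [dsub]
    have := abs_le_of_sq_le_sq (by linarith : dot d (o.p₁ - q) ^ 2 ≤ dot d (x - q) ^ 2)
      (hW x hx).1
    linarith [le_abs_self (dot d (o.p₁ - q))]
  have L' : ∀ x ∈ V, dot d (x - o.p₂) = 0 → 0 ≤ cross d (x - o.p₂) := by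
    intro x hx h
    rw [dsub, ht0, sub_zero] at h
    have h1 := hm₂ x ⟨hin x hx, (o.wedge.mem_arm₂_iff _).2 ⟨h, (hW x hx).2⟩⟩
    have h2 := pow_le_pow_left₀ dist_nonneg h1 2
    rw [dist_eq_frame hd, dist_eq_frame hd, ht0, h] at h2
    rw [csub]
    have := abs_le_of_sq_le_sq (by linarith : cross d (o.p₂ - q) ^ 2 ≤ cross d (x - q) ^ 2)
      (hW x hx).2
    linarith [le_abs_self (cross d (o.p₂ - q))]
  have inj : ∀ w, dot d w = 0 → cross d w = 0 → w = 0 := by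
    intro w h1 h2
    rw [eq_frame hd w, h1, h2]; simp
  have m₁ : o.p₁ ∈ V := mem_of_lex_min (a := I * d) (b := d) hp₁
    (fun w h1 h2 => inj w h2 (by rw [cross_eq_dot]; exact h1))
    (fun x hx => by rw [← cross_eq_dot]; exact R x hx)
    (fun x hx h => R' x hx (by rw [cross_eq_dot]; exact h))
  have m₂ : o.p₂ ∈ V := mem_of_lex_min (a := d) (b := I * d) hp₂
    (fun w h1 h2 => inj w h1 (by rw [cross_eq_dot]; exact h2)) Lf
    (fun x hx h => by rw [← cross_eq_dot]; exact L' x hx h)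
  have hne : o.p₁ ≠ o.p₂ := by
    intro h
    have := hV.cross_neg m₂ (ne_zero_of_dot_self hd) (ne_zero_of_dot_self hd) Lf (h ▸ R)
    rw [cross_self] at this
    exact lt_irrefl _ this
  have hq : q ∉ convexHull ℝ (V : Set ℂ) := by
    intro hq
    have h1 := hm₁ q ⟨hq, (o.wedge.mem_arm₁_iff _).2 (by
      change 0 ≤ dot d (q - q) ∧ cross d (q - q) = 0; simp [dot, cross])⟩
    have h2 := hm₂ q ⟨hq, (o.wedge.mem_arm₂_iff _).2 (by
      change dot d (q - q) = 0 ∧ 0 ≤ cross d (q - q); simp [dot, cross])⟩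
    rw [dist_self] at h1 h2
    exact hne ((dist_le_zero.1 h1).symm.trans (dist_le_zero.1 h2))
  have hs' : 0 < dot d (o.p₁ - q) := by
    refine lt_of_le_of_ne hs fun h => hq ?_
    rwa [show q = o.p₁ from (sub_eq_zero.1 (inj _ h.symm hs0)).symm]
  have ht' : 0 < cross d (o.p₂ - q) := by
    refine lt_of_le_of_ne ht fun h => hq ?_
    rwa [show q = o.p₂ from (sub_eq_zero.1 (inj _ ht0 h.symm)).symm]
  refine ⟨⟨hd, m₁, m₂, R, Lf, R', L', ?_, ?_⟩, hs', hs0, ht0, ht', hq⟩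
  · rw [dsub, ht0, sub_zero]; exact hs'
  · rw [csub, hs0, sub_zero]; exact ht'

/-- The apex lies on the line strictly before `a`, so `a` is the first point of the polygon on an arm
that runs along the line. -/
lemma ObtuseVertexSet.along (hV : ObtuseVertexSet V) {a b : ℂ} (hab : a ≠ b) (ha : a ∈ V)
    (hb : b ∈ V) {o : Outcome}
    (ho : IsOutcome (Real.pi / 2) (convexHull ℝ (V : Set ℂ)) (.through a b hab) o) :
    Along V o.wedge.dir o.p₁ o.p₂ a b := by
  obtain ⟨hT, hs, hs0, ht0, ht, hq⟩ := hV.touch ho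
  obtain ⟨⟨⟨hsub, -, -⟩, ⟨τ, hτ⟩, ⟨t, htnn, htO⟩⟩, -, -⟩ := ho
  have hd := hT.unit
  set d := o.wedge.dir
  set q := o.apex
  set m := b - a with hm
  have hm0 : m ≠ 0 := sub_ne_zero.2 hab.symm
  change q = a + τ * m at hτ
  change q + t * m ∈ _ at htO
  have scal_dot : ∀ (r : ℝ) z, dot d (r * z) = r * dot d z := by
    intro r z; simp [dot]; ring
  have scal_cross : ∀ (r : ℝ) z, cross d (r * z) = r * cross d z := by
    intro r z; simp [cross]; ring
  have htpos : 0 < t := by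
    refine lt_of_le_of_ne htnn ?_
    rintro rfl
    apply hq; simpa using htO
  have hmW := (o.wedge.mem_carrier_iff _).1 (hsub htO)
  change 0 ≤ dot d (q + t * m - q) ∧ 0 ≤ cross d (q + t * m - q) at hmW
  rw [add_sub_cancel_left, scal_dot, scal_cross] at hmW
  have dm : 0 ≤ dot d m := nonneg_of_mul_nonneg_right hmW.1 htpos
  have cm : 0 ≤ cross d m := nonneg_of_mul_nonneg_right hmW.2 htpos
  have hin : ∀ x ∈ V, x ∈ convexHull ℝ (V : Set ℂ) := fun x hx => subset_convexHull _ _ hx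
  have hW : ∀ x ∈ V, 0 ≤ dot d (x - q) ∧ 0 ≤ cross d (x - q) := fun x hx =>
    (o.wedge.mem_carrier_iff x).1 (hsub (hin x hx))
  have hnz : dot d m ≠ 0 ∨ cross d m ≠ 0 := by
    by_contra! h
    apply hm0
    rw [eq_frame hd m, h.1, h.2]; simp
  have haq : a - q = ((-τ : ℝ) : ℂ) * m := by rw [hτ]; push_cast; ring
  have hτ0 : τ < 0 := by
    have h1 := hW a ha
    rw [haq, scal_dot, scal_cross] at h1
    rcases lt_trichotomy τ 0 with h | h | h
    · exact h
    · exfalso; apply hq; rw [hτ, h]; simpa using hin a ha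
    · exfalso
      rcases hnz with h2 | h2
      · have := lt_of_le_of_ne dm (Ne.symm h2); nlinarith
      · have := lt_of_le_of_ne cm (Ne.symm h2); nlinarith
  -- positions relative to the line, seen from the apex
  have rel : ∀ x, cross m (x - a) = dot d m * cross d (x - q) - cross d m * dot d (x - q) := by
    intro x
    rw [← cross_frame hd m (x - q), show x - a = x - q - ((-τ : ℝ) : ℂ) * m by rw [← haq]; ring]
    simp [cross]; ring
  -- a contact point on the line is `a`, for otherwise `a` would be between it and `b`
  have onL : ∀ x ∈ V, ∀ r : ℝ, x - a = r * m → r ≤ 0 → x = a := by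
    intro x hx r hxr hr
    by_contra hxa
    obtain ⟨f, hf⟩ := hV.extreme a ha
    have h1 := hf x hx hxa
    have h2 := hf b hb hab.symm
    rw [hxr, show cross f (r * m) = r * cross f m by simp [cross]; ring] at h1
    nlinarith
  have dsub : ∀ x y, dot d (x - y) = dot d (x - q) - dot d (y - q) := by
    intro x y; simp only [dot, sub_re, sub_im]; ring
  have csub : ∀ x y, cross d (x - y) = cross d (x - q) - cross d (y - q) := by
    intro x y; simp only [cross, sub_re, sub_im]; ring
  have hda : dot d (a - q) = -τ * dot d m := by rw [haq, scal_dot]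
  have hca : cross d (a - q) = -τ * cross d m := by rw [haq, scal_cross]
  refine ⟨dm, cm, ?_, ?_⟩
  · rcases cm.eq_or_lt with h | h
    · right
      have dm' : 0 < dot d m := lt_of_le_of_ne dm (Ne.symm (hnz.resolve_right (by simp [← h])))
      refine ⟨?_, h.symm, fun x hx => ?_⟩
      · have h1 := hT.right_min a ha (by rw [csub, hs0, hca, ← h]; ring)
        refine onL _ hT.mem₁ (dot d (o.p₁ - a) / dot d m) ?_ ?_
        · apply eq_of_frame hd
          · rw [scal_dot, div_mul_cancel₀ _ dm'.ne']
          · rw [scal_cross, csub, hs0, hca, ← h]; ring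
        · apply div_nonpos_of_nonpos_of_nonneg _ dm
          rw [dsub] at h1 ⊢; linarith
      · rw [rel, ← h, zero_mul, sub_zero]
        exact mul_nonneg dm (hW x hx).2
    · left
      refine ⟨?_, h⟩
      rw [rel, hs0]
      nlinarith
  · rcases dm.eq_or_lt with h | h
    · right
      have cm' : 0 < cross d m := lt_of_le_of_ne cm (Ne.symm (hnz.resolve_left (by simp [← h])))
      refine ⟨?_, h.symm, fun x hx => ?_⟩
      · have h1 := hT.left_min a ha (by rw [dsub, ht0, hda, ← h]; ring)
        refine onL _ hT.mem₂ (cross d (o.p₂ - a) / cross d m) ?_ ?_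
        · apply eq_of_frame hd
          · rw [scal_dot, dsub, ht0, hda, ← h]; ring
          · rw [scal_cross, div_mul_cancel₀ _ cm'.ne']
        · apply div_nonpos_of_nonpos_of_nonneg _ cm
          rw [csub] at h1 ⊢; linarith
      · rw [rel, ← h, zero_mul, zero_sub]
        have := mul_nonneg cm (hW x hx).1
        linarith
    · left
      refine ⟨?_, h⟩
      rw [rel, ht0]
      nlinarith

/-! ### The initialization and the hit step -/

/-- If a first arm in the direction `d` touches the vertex `v`, then a probe that starts from `v`
turns its first arm by at most `π / 2` away from `d`. -/
lemma Along.dot_nonneg_of_touch {d e p₁ p₂ v b : ℂ} (hA : Along V e p₁ p₂ v b)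
    (hT : Touch V e p₁ p₂) (hb : b ∈ V) (hd : ∀ x ∈ V, 0 ≤ cross d (x - v)) (hv : v ∈ V) :
    0 ≤ dot d e := by
  have he := hT.unit
  have hm := hd b hb
  rcases hA.left with ⟨h, -⟩ | ⟨-, h, -⟩
  · have hw := hd p₂ hT.mem₂
    have hl : dot e (p₂ - v) ≤ 0 := by
      have := hT.left v hv
      have e1 : dot e (p₂ - v) = -dot e (v - p₂) := by simp only [dot, sub_re, sub_im]; ring
      linarith
    have key : cross (b - v) (p₂ - v) * dot d e = cross d (p₂ - v) * dot e (b - v)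
        - cross d (b - v) * dot e (p₂ - v) := by simp only [dot, cross]; ring
    have h1 := mul_nonneg hw hA.dot_nonneg
    have h2 := mul_nonneg hm (neg_nonneg.2 hl)
    by_contra! h3
    nlinarith
  · have hc := hA.cross_nonneg
    rw [cross_frame he, h] at hm
    have hcpos : 0 < cross e (b - v) ∨ cross e (b - v) = 0 := by
      rcases hc.lt_or_eq with h | h
      · exact .inl h
      · exact .inr h.symm
    rcases hcpos with hc | hc
    · rw [dot_comm d e]
      by_contra! h3
      nlinarith
    · exfalso
      rcases hA.right with ⟨-, h'⟩ | ⟨h', -⟩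
      · exact h'.ne' hc
      · have := hA.left
        rcases this with ⟨-, h2⟩ | ⟨h2, -⟩
        · exact h2.ne' h
        · have := hT.dot_pos
          rw [h', h2] at this
          simp [dot] at this

/-- The two probes of the initialization in its first case: the first arm turns by an acute angle
counterclockwise from the first to the second of them. -/
lemma Touch.acute_turn {d d' v₁ v₂ v₃ v₄ : ℂ} (h₁ : Touch V d v₁ v₂) (h₂ : Touch V d' v₃ v₄)
    (hA : Along V d' v₃ v₄ v₁ v₂) (hne : v₄ ≠ v₁) : 0 < dot d d' ∧ 0 < cross d d' := by
  have hu := h₁.unit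
  have hu' := h₂.unit
  rcases hA.left with ⟨hl, -⟩ | ⟨h, -⟩
  swap
  · exact absurd h hne
  have a₁ := h₁.dot_pos
  have a₂ := h₁.cross_pos
  have b₁ := hA.dot_nonneg
  have b₂ := hA.cross_nonneg
  have c₁ := h₂.left v₁ h₁.mem₁
  have c₂ := h₁.right v₄ h₂.mem₂
  have c₃ := h₁.right_min v₄ h₂.mem₂
  have e₁ : dot d (v₂ - v₁) = -dot d (v₁ - v₂) := by simp only [dot, sub_re, sub_im]; ring
  have e₂ : dot d' (v₁ - v₄) = -dot d' (v₄ - v₁) := by simp only [dot, sub_re, sub_im]; ring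
  rw [e₂] at c₁
  rw [dot_frame hu] at hu' b₁ c₁
  rw [cross_frame hu] at hl b₂
  rw [e₁] at hl b₁ b₂
  set A := dot d (v₁ - v₂)
  set B := cross d (v₂ - v₁)
  set x := dot d d'
  set y := cross d d'
  set z₁ := dot d (v₄ - v₁)
  set z₂ := cross d (v₄ - v₁)
  have hy0 : 0 ≤ y := by
    by_contra! h
    nlinarith [mul_nonneg b₁ a₂.le, mul_nonneg b₂ a₁.le,
      mul_pos (neg_pos.2 h) (add_pos (mul_pos a₁ a₁) (mul_pos a₂ a₂))]
  have hz₁ : z₁ < 0 := by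
    by_contra! h
    nlinarith [mul_nonneg a₁.le c₂, mul_nonneg a₂.le h]
  have hz₂ : 0 < z₂ := lt_of_le_of_ne c₂ fun h => by linarith [c₃ h.symm]
  have hy : 0 < y := by
    refine lt_of_le_of_ne hy0 fun h => ?_
    rw [← h] at b₁ b₂ hu'
    have hx : x = 0 := by nlinarith
    rw [hx] at hu'
    norm_num at hu'
  refine ⟨?_, hy⟩
  by_contra! hx
  nlinarith [mul_pos hy hz₂, mul_nonneg (neg_nonneg.2 hx) (neg_nonneg.2 hz₁.le)]

/-- The second contact point of a probe along a chord with vertices on both sides is strictly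
to the left. -/
lemma Along.left_of_mem {e p₁ p₂ a b x : ℂ} (hA : Along V e p₁ p₂ a b) (hx : x ∈ V)
    (h : 0 < cross (b - a) (x - a)) : 0 < cross (b - a) (p₂ - a) := by
  rcases hA.left with h' | ⟨-, -, h'⟩
  · exact h'.1
  · exact absurd (h' x hx) (not_le.2 h)

lemma Along.right_of_mem {e p₁ p₂ a b x : ℂ} (hA : Along V e p₁ p₂ a b) (hx : x ∈ V)
    (h : cross (b - a) (x - a) < 0) : cross (b - a) (p₁ - a) < 0 := by
  rcases hA.right with h' | ⟨-, -, h'⟩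
  · exact h'.1
  · exact absurd (h' x hx) (not_le.2 h)

/-- The second probe of the initialization finds a vertex strictly beyond the line through the
first two vertices: otherwise the polygon would lie in a right triangle with hypotenuse `v₁ v₂`. -/
lemma ObtuseVertexSet.second_right (hV : ObtuseVertexSet V) {d d' v₁ v₂ p₁ p₂ : ℂ}
    (h₁ : Touch V d v₁ v₂) (hA : Along V d' p₁ p₂ v₁ v₂) : cross (v₂ - v₁) (p₁ - v₁) < 0 := by
  rcases hA.right with h | ⟨-, -, h⟩
  · exact h.1
  · exfalso
    have hm : v₂ - v₁ ≠ 0 := by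
      intro h0
      have := h₁.cross_pos
      rw [h0] at this
      simp [cross] at this
    have := hV.dot_normals_pos h₁.mem₁ (mul_ne_zero I_ne_zero h₁.dir_ne_zero)
      (mul_ne_zero I_ne_zero hm) (fun x hx => by rw [← cross_eq_dot]; exact h₁.right x hx)
      (fun x hx => by rw [← cross_eq_dot]; exact h x hx)
    have e : dot (I * d) (I * (v₂ - v₁)) = -dot d (v₁ - v₂) := by simp [dot]; ring
    rw [e] at this
    linarith [h₁.dot_pos]

/-- The hit step along `v₃ v₁`: the first arm has turned from `d` by at least `π / 2`, but from
`d'` by at most `π / 2`. -/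
lemma ObtuseVertexSet.hit31 (hV : ObtuseVertexSet V) {d d' e v₁ v₂ v₃ v₄ p₁ p₂ : ℂ}
    (h₁ : Touch V d v₁ v₂) (h₂ : Touch V d' v₃ v₄) (hA : Along V d' v₃ v₄ v₁ v₂) (hne : v₄ ≠ v₁)
    (h₃ : Touch V e p₁ p₂) (hE : Along V e p₁ p₂ v₃ v₁) :
    p₁ ≠ v₁ ∧ p₁ ≠ v₂ ∧ p₁ ≠ v₃ ∧ p₁ ≠ v₄ ∧ p₁ ≠ p₂ ∧
      (p₂ = v₃ ∧ (∀ x ∈ V, 0 ≤ cross (v₃ - v₁) (x - v₁)) ∨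
        p₂ ≠ v₁ ∧ p₂ ≠ v₂ ∧ p₂ ≠ v₃ ∧ p₂ ≠ v₄) := by
  obtain ⟨hx, hy⟩ := h₁.acute_turn h₂ hA hne
  have hr := hV.second_right h₁ hA
  have hl : 0 < cross (v₂ - v₁) (v₄ - v₁) := by
    rcases hA.left with h | h
    · exact h.1
    · exact absurd h.1 hne
  have hr' : cross (v₁ - v₃) (v₂ - v₃) < 0 := by rwa [cross_rotate]
  have hp₁ := hE.right_of_mem h₁.mem₂ hr'
  have hquad := hV.cross_pos_of_separated h₁.mem₁ h₂.mem₁ h₁.mem₂ h₂.mem₂ hr hl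
  rw [cross_swap] at hquad
  have hd := h₁.unit
  have hD := hE.dot_nonneg_of_touch h₃ h₁.mem₁ h₂.right h₂.mem₁
  have hC : dot d e ≤ 0 := by
    have hm₂ : cross d (v₁ - v₃) ≤ 0 := by
      have := h₁.right v₃ h₂.mem₁
      have e1 : cross d (v₁ - v₃) = -cross d (v₃ - v₁) := by simp only [cross, sub_re, sub_im]; ring
      linarith
    have hm' := h₂.right v₁ h₁.mem₁
    rw [cross_frame hd] at hm'
    have hm₁ : dot d (v₁ - v₃) ≤ 0 := by
      by_contra! h
      nlinarith [mul_pos hy h]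
    have hm0 : v₁ - v₃ ≠ 0 := by
      intro h0
      rw [h0] at hr'; simp [cross] at hr'
    have := dot_self_pos hm0
    have key : dot (v₁ - v₃) (v₁ - v₃) * dot d e = dot e (v₁ - v₃) * dot d (v₁ - v₃)
        + cross e (v₁ - v₃) * cross d (v₁ - v₃) := by simp only [dot, cross]; ring
    by_contra! h
    nlinarith [mul_pos this h, mul_nonneg hE.dot_nonneg (neg_nonneg.2 hm₁),
      mul_nonneg hE.cross_nonneg (neg_nonneg.2 hm₂)]
  have hs : 0 ≤ cross d e := by
    rw [dot_frame hd] at hD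
    by_contra! h
    nlinarith [mul_pos hy (neg_pos.2 h), mul_nonneg hx.le (neg_nonneg.2 hC)]
  have hs' : 0 ≤ cross d' e := by
    rw [cross_frame hd]
    nlinarith [mul_nonneg hx.le hs, mul_nonneg hy.le (neg_nonneg.2 hC)]
  refine ⟨?_, ?_, ?_, ?_, ?_, ?_⟩
  · rintro rfl; rw [cross_self] at hp₁; exact lt_irrefl _ hp₁
  · intro h
    exact not_lt.2 hs (hV.cross_neg h₁.mem₂ h₁.dir_ne_zero h₃.dir_ne_zero h₁.left (h ▸ h₃.right))
  · rintro rfl; simp [cross] at hp₁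
  · intro h
    exact not_lt.2 hs' (hV.cross_neg h₂.mem₂ h₂.dir_ne_zero h₃.dir_ne_zero h₂.left (h ▸ h₃.right))
  · intro h
    have := h₃.dot_pos
    rw [h] at this
    simp [dot] at this
  · rcases hE.left with ⟨h, -⟩ | ⟨h, -, h'⟩
    · right
      refine ⟨?_, ?_, ?_, ?_⟩
      · rintro rfl; rw [cross_self] at h; exact lt_irrefl _ h
      · rintro rfl; linarith
      · rintro rfl; simp [cross] at h
      · rintro rfl; linarith
    · left
      refine ⟨h, fun x hx => ?_⟩
      rw [cross_swap]
      linarith [h' x hx]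

/-- The hit step along `v₂ v₄`: the first arm turns from `d` by at most `π / 2`, and from `d'` by at
least `π / 2`. -/
lemma ObtuseVertexSet.hit24 (hV : ObtuseVertexSet V) {d d' e v₁ v₂ v₃ v₄ p₁ p₂ : ℂ}
    (h₁ : Touch V d v₁ v₂) (h₂ : Touch V d' v₃ v₄) (hA : Along V d' v₃ v₄ v₁ v₂) (hne : v₄ ≠ v₁)
    (h₃ : Touch V e p₁ p₂) (hE : Along V e p₁ p₂ v₂ v₄) :
    p₂ ≠ v₁ ∧ p₂ ≠ v₂ ∧ p₂ ≠ v₃ ∧ p₂ ≠ v₄ ∧ p₂ ≠ p₁ ∧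
      (p₁ = v₂ ∧ (∀ x ∈ V, 0 ≤ cross (v₄ - v₂) (x - v₂)) ∨
        p₁ ≠ v₁ ∧ p₁ ≠ v₂ ∧ p₁ ≠ v₃ ∧ p₁ ≠ v₄) := by
  obtain ⟨hx, hy⟩ := h₁.acute_turn h₂ hA hne
  have hr := hV.second_right h₁ hA
  have hl : 0 < cross (v₂ - v₁) (v₄ - v₁) := by
    rcases hA.left with h | h
    · exact h.1
    · exact absurd h.1 hne
  have hl' : 0 < cross (v₄ - v₂) (v₁ - v₂) := by rwa [← cross_rotate]
  have hp₂ := hE.left_of_mem h₁.mem₁ hl'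
  have hquad : 0 < cross (v₄ - v₂) (v₃ - v₂) := by
    apply hV.cross_pos_of_separated h₁.mem₂ h₂.mem₂ h₁.mem₁ h₂.mem₁
    · rw [cross_swap]; linarith
    · rw [cross_swap]; linarith
  have hd := h₁.unit
  have hm0 : v₄ - v₂ ≠ 0 := by
    intro h0
    rw [h0] at hl'; simp [cross] at hl'
  have hmm := dot_self_pos hm0
  have hm₁ : 0 ≤ dot d (v₄ - v₂) := h₁.left v₄ h₂.mem₂
  have hC : 0 ≤ dot d e := by
    rcases hE.right with ⟨h, -⟩ | ⟨-, h, -⟩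
    · have hw : 0 ≤ dot d (p₁ - v₂) := h₁.left p₁ h₃.mem₁
      have hl : cross e (p₁ - v₂) ≤ 0 := by
        have := h₃.right v₂ h₁.mem₂
        have e1 : cross e (p₁ - v₂) = -cross e (v₂ - p₁) := by
          simp only [cross, sub_re, sub_im]; ring
        linarith
      have key : cross (v₄ - v₂) (p₁ - v₂) * dot d e = dot d (v₄ - v₂) * cross e (p₁ - v₂)
          - dot d (p₁ - v₂) * cross e (v₄ - v₂) := by simp only [dot, cross]; ring
      by_contra! h3
      nlinarith [mul_pos (neg_pos.2 h) (neg_pos.2 h3), mul_nonneg hm₁ (neg_nonneg.2 hl),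
        mul_nonneg hw hE.cross_nonneg]
    · have key : dot (v₄ - v₂) (v₄ - v₂) * dot d e = dot e (v₄ - v₂) * dot d (v₄ - v₂)
        + cross e (v₄ - v₂) * cross d (v₄ - v₂) := by simp only [dot, cross]; ring
      rw [h, zero_mul, add_zero] at key
      by_contra! h3
      nlinarith [mul_nonneg hE.dot_nonneg hm₁]
  have hD : dot d' e ≤ 0 := by
    have hm' : dot d' (v₄ - v₂) ≤ 0 := by
      have := h₂.left v₂ h₁.mem₂
      have e1 : dot d' (v₄ - v₂) = -dot d' (v₂ - v₄) := by simp only [dot, sub_re, sub_im]; ring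
      linarith
    have hm₂ : cross d (v₄ - v₂) ≤ 0 := by
      rw [dot_frame hd] at hm'
      by_contra! h
      nlinarith [mul_pos hy h, mul_nonneg hx.le hm₁]
    have hm'' : cross d' (v₄ - v₂) ≤ 0 := by
      rw [cross_frame hd]
      nlinarith [mul_nonneg hx.le (neg_nonneg.2 hm₂), mul_nonneg hy.le hm₁]
    have key : dot (v₄ - v₂) (v₄ - v₂) * dot d' e = dot e (v₄ - v₂) * dot d' (v₄ - v₂)
        + cross e (v₄ - v₂) * cross d' (v₄ - v₂) := by simp only [dot, cross]; ring
    by_contra! h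
    nlinarith [mul_pos hmm h, mul_nonneg hE.dot_nonneg (neg_nonneg.2 hm'),
      mul_nonneg hE.cross_nonneg (neg_nonneg.2 hm'')]
  have hs : cross d e ≤ 0 := by
    rw [dot_frame hd] at hD
    by_contra! h
    nlinarith [mul_pos hy h, mul_nonneg hx.le hC]
  have hs' : cross d' e ≤ 0 := by
    rw [cross_frame hd]
    nlinarith [mul_nonneg hx.le (neg_nonneg.2 hs), mul_nonneg hy.le hC]
  refine ⟨?_, ?_, ?_, ?_, ?_, ?_⟩
  · intro h
    have := hV.cross_neg h₁.mem₁ h₃.dir_ne_zero h₁.dir_ne_zero (h ▸ h₃.left) h₁.right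
    rw [cross_comm] at this
    linarith
  · rintro rfl; simp [cross] at hp₂
  · intro h
    have := hV.cross_neg h₂.mem₁ h₃.dir_ne_zero h₂.dir_ne_zero (h ▸ h₃.left) h₂.right
    rw [cross_comm] at this
    linarith
  · rintro rfl; rw [cross_self] at hp₂; exact lt_irrefl _ hp₂
  · intro h
    have := h₃.dot_pos
    rw [h] at this
    simp [dot] at this
  · rcases hE.right with ⟨h, -⟩ | ⟨h, -, h'⟩
    · right
      refine ⟨?_, ?_, ?_, ?_⟩
      · rintro rfl; linarith
      · rintro rfl; simp [cross] at h
      · rintro rfl; linarith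
      · rintro rfl; rw [cross_self] at h; exact lt_irrefl _ h
    · exact .inl ⟨h, h'⟩

/-- The third probe of the initialization: its points of contact lie strictly on either side of
the line from `v₄` to `v₂`, and its first arm is turned counterclockwise from `d'` by an angle in
`(0, π / 2]`. -/
lemma ObtuseVertexSet.third (hV : ObtuseVertexSet V) {d d' e v₁ v₂ v₃ v₄ v : ℂ}
    (h₁ : Touch V d v₁ v₂) (h₂ : Touch V d' v₄ v₁) (hA : Along V d' v₄ v₁ v₁ v₂)
    (h₃ : Touch V e v₃ v) (hE : Along V e v₃ v v₄ v₂) :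
    cross (v₂ - v₄) (v₃ - v₄) < 0 ∧ 0 < cross (v₂ - v₄) (v - v₄) ∧ 0 ≤ dot d' e ∧
      0 < cross d' e := by
  have hr := hV.second_right h₁ hA
  have hl : 0 < cross (v₂ - v₄) (v₁ - v₄) := by
    have : cross (v₂ - v₄) (v₁ - v₄) = -cross (v₂ - v₁) (v₄ - v₁) := by
      simp only [cross, sub_re, sub_im]; ring
    linarith
  have hdl : dot d' (v₂ - v₁) = 0 := by
    rcases hA.left with ⟨h, -⟩ | ⟨-, h, -⟩
    · simp [cross] at h
    · exact h
  have hm0 : v₂ - v₄ ≠ 0 := by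
    intro h0
    rw [h0] at hl; simp [cross] at hl
  have hcm := h₂.right v₂ h₁.mem₂
  have hr₃ : cross (v₂ - v₄) (v₃ - v₄) < 0 ∧ 0 < cross e (v₂ - v₄) := by
    rcases hE.right with h | ⟨-, -, h⟩
    · exact h
    · exfalso
      have hleft : ∀ x ∈ V, 0 ≤ dot d' (x - v₂) := fun x hx => by
        have := h₂.left x hx
        have e1 : dot d' (x - v₂) = dot d' (x - v₁) - dot d' (v₂ - v₁) := by
          simp only [dot, sub_re, sub_im]; ring
        linarith
      have hsup : ∀ x ∈ V, 0 ≤ cross (v₂ - v₄) (x - v₂) := fun x hx => by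
        have := h x hx
        rwa [show cross (v₂ - v₄) (x - v₂) = cross (v₂ - v₄) (x - v₄) by
          simp only [cross, sub_re, sub_im]; ring]
      exact not_lt.2 hcm (hV.cross_neg h₁.mem₂ h₂.dir_ne_zero hm0 hleft hsup)
  have hdm : dot d' (v₂ - v₄) < 0 := by
    have := h₂.dot_pos
    have e1 : dot d' (v₂ - v₄) = dot d' (v₂ - v₁) - dot d' (v₄ - v₁) := by
      simp only [dot, sub_re, sub_im]; ring
    linarith
  refine ⟨hr₃.1, hE.left_of_mem h₁.mem₁ hl,
    hE.dot_nonneg_of_touch h₃ h₁.mem₂ h₂.right h₂.mem₁, ?_⟩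
  have key : dot (v₂ - v₄) (v₂ - v₄) * cross d' e = dot e (v₂ - v₄) * cross d' (v₂ - v₄)
      - cross e (v₂ - v₄) * dot d' (v₂ - v₄) := by simp only [dot, cross]; ring
  have h1 := mul_nonneg hE.dot_nonneg hcm
  have h2 := mul_pos hr₃.2 (neg_pos.2 hdm)
  have h3 := dot_self_pos hm0
  by_contra! h
  nlinarith

/-- The hit step in the second case: the first arm has turned by at least `π / 2` from `d'`,
but by at most `π / 2` from the direction `d''` of the third probe. -/
lemma ObtuseVertexSet.hit34 (hV : ObtuseVertexSet V) {d d' d'' e v₁ v₂ v₃ v₄ v p₁ p₂ : ℂ}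
    (h₁ : Touch V d v₁ v₂) (h₂ : Touch V d' v₄ v₁) (hA : Along V d' v₄ v₁ v₁ v₂)
    (h₃ : Touch V d'' v₃ v) (hB : Along V d'' v₃ v v₄ v₂)
    (h₄ : Touch V e p₁ p₂) (hE : Along V e p₁ p₂ v₃ v₄) :
    (p₁ ≠ v₁ ∧ p₁ ≠ v₂ ∧ p₁ ≠ v₃ ∧ p₁ ≠ v₄ ∧ p₁ ≠ v) ∧ p₁ ≠ p₂ ∧
      (p₂ = v₃ ∧ (∀ x ∈ V, 0 ≤ cross (v₃ - v₄) (x - v₄)) ∨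
        p₂ ≠ v₁ ∧ p₂ ≠ v₂ ∧ p₂ ≠ v₃ ∧ p₂ ≠ v₄ ∧ p₂ ≠ v) := by
  obtain ⟨hr₃, hlv, hD', hC'⟩ := hV.third h₁ h₂ hA h₃ hB
  have hr := hV.second_right h₁ hA
  have hl : 0 < cross (v₂ - v₄) (v₁ - v₄) := by
    have : cross (v₂ - v₄) (v₁ - v₄) = -cross (v₂ - v₁) (v₄ - v₁) := by
      simp only [cross, sub_re, sub_im]; ring
    linarith
  have q₁ := hV.cross_pos_of_separated h₂.mem₁ h₃.mem₁ h₁.mem₂ h₁.mem₁ hr₃ hl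
  have qv := hV.cross_pos_of_separated h₂.mem₁ h₃.mem₁ h₁.mem₂ h₃.mem₂ hr₃ hlv
  rw [cross_swap] at q₁ qv
  have q₂ : cross (v₄ - v₃) (v₂ - v₃) < 0 := by rwa [cross_rotate]
  have hp₁ := hE.right_of_mem h₁.mem₂ q₂
  have hdl : dot d' (v₂ - v₁) = 0 := by
    rcases hA.left with ⟨h, -⟩ | ⟨-, h, -⟩
    · simp [cross] at h
    · exact h
  have hd := h₂.unit
  have hm0 : v₄ - v₃ ≠ 0 := by
    intro h0
    rw [h0] at hp₁; simp [cross] at hp₁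
  have hmm := dot_self_pos hm0
  have hDe := hE.dot_nonneg_of_touch h₄ h₂.mem₁ h₃.right h₃.mem₁
  -- seen from `v₄`, the direction of `v₃` is within an angle `π / 2` of `d'`
  have hcm : cross d' (v₄ - v₃) ≤ 0 := by
    have := h₂.right v₃ h₃.mem₁
    have e1 : cross d' (v₄ - v₃) = -cross d' (v₃ - v₄) := by simp only [cross, sub_re, sub_im]; ring
    linarith
  have hdm : dot d' (v₄ - v₃) ≤ 0 := by
    have := h₃.right v₄ h₂.mem₁
    rw [cross_frame hd] at this
    by_contra! h
    nlinarith [mul_pos hC' h, mul_nonneg hD' (neg_nonneg.2 hcm)]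
  have hC : dot d' e ≤ 0 := by
    have key : dot (v₄ - v₃) (v₄ - v₃) * dot d' e = dot e (v₄ - v₃) * dot d' (v₄ - v₃)
        + cross e (v₄ - v₃) * cross d' (v₄ - v₃) := by simp only [dot, cross]; ring
    by_contra! h
    nlinarith [mul_pos hmm h, mul_nonneg hE.dot_nonneg (neg_nonneg.2 hdm),
      mul_nonneg hE.cross_nonneg (neg_nonneg.2 hcm)]
  have hs' : 0 ≤ cross d' e := by
    rw [dot_frame hd] at hDe
    by_contra! h
    nlinarith [mul_pos hC' (neg_pos.2 h), mul_nonneg hD' (neg_nonneg.2 hC)]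
  have hs : 0 ≤ cross d'' e := by
    rw [cross_frame hd]
    nlinarith [mul_nonneg hD' hs', mul_nonneg hC'.le (neg_nonneg.2 hC)]
  have hleft : ∀ x ∈ V, 0 ≤ dot d' (x - v₂) := fun x hx => by
    have := h₂.left x hx
    have e1 : dot d' (x - v₂) = dot d' (x - v₁) - dot d' (v₂ - v₁) := by
      simp only [dot, sub_re, sub_im]; ring
    linarith
  refine ⟨⟨?_, ?_, ?_, ?_, ?_⟩, ?_, ?_⟩
  · intro h
    exact not_lt.2 hs' (hV.cross_neg h₂.mem₂ h₂.dir_ne_zero h₄.dir_ne_zero h₂.left (h ▸ h₄.right))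
  · intro h
    exact not_lt.2 hs' (hV.cross_neg h₁.mem₂ h₂.dir_ne_zero h₄.dir_ne_zero hleft (h ▸ h₄.right))
  · rintro rfl; simp [cross] at hp₁
  · rintro rfl; rw [cross_self] at hp₁; exact lt_irrefl _ hp₁
  · intro h
    exact not_lt.2 hs (hV.cross_neg h₃.mem₂ h₃.dir_ne_zero h₄.dir_ne_zero h₃.left (h ▸ h₄.right))
  · intro h
    have := h₄.dot_pos
    rw [h] at this
    simp [dot] at this
  · rcases hE.left with ⟨h, -⟩ | ⟨h, -, h'⟩
    · right
      refine ⟨?_, ?_, ?_, ?_, ?_⟩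
      · rintro rfl; linarith
      · rintro rfl; linarith
      · rintro rfl; simp [cross] at h
      · rintro rfl; rw [cross_self] at h; exact lt_irrefl _ h
      · rintro rfl; linarith
    · left
      refine ⟨h, fun x hx => ?_⟩
      rw [cross_swap]
      linarith [h' x hx]

/-! ### Every line that meets the polygon admits a probe -/

lemma isLinearMap_dot (c : ℂ) : IsLinearMap ℝ (dot c) where
  map_add x y := by simp only [dot, add_re, add_im]; ring
  map_smul r x := by simp [dot]; ring

lemma continuous_dot (c : ℂ) : Continuous (dot c) := by
  unfold dot; fun_prop

lemma continuous_cross (c : ℂ) : Continuous (cross c) := by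
  unfold cross; fun_prop

lemma le_dot_of_mem_convexHull {c x : ℂ} {r : ℝ} (h : ∀ y ∈ V, r ≤ dot c y)
    (hx : x ∈ convexHull ℝ (V : Set ℂ)) : r ≤ dot c x :=
  convexHull_min (t := {y | r ≤ dot c y}) (fun y hy => h y hy)
    (convex_halfSpace_ge (isLinearMap_dot c) r) hx

lemma le_cross_of_mem_convexHull {c x : ℂ} {r : ℝ} (h : ∀ y ∈ V, r ≤ cross c y)
    (hx : x ∈ convexHull ℝ (V : Set ℂ)) : r ≤ cross c x := by
  rw [cross_eq_dot]
  exact le_dot_of_mem_convexHull (fun y hy => by rw [← cross_eq_dot]; exact h y hy) hx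

lemma exists_isClosestIn {S : Set ℂ} (hc : IsCompact S) (hn : S.Nonempty) (q : ℂ) :
    ∃ x, IsClosestIn S q x := by
  obtain ⟨x, hx, h⟩ := hc.exists_isMinOn hn (continuous_const.dist continuous_id).continuousOn
    (f := fun y => dist q y)
  exact ⟨x, hx, fun y hy => h hy⟩

/-- The apex of the right-angled wedge that has a given direction and is supported by the polygon
moves continuously with the direction.  When the first arm is parallel to `L`, the apex is to the
right of `L` or on it; after a clockwise turn by `π / 2` it is to the left or on it. -/
lemma exists_isOutcome (L : DirectedLine) {z : ℂ} (hzL : z ∈ L.carrier)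
    (hz : z ∈ convexHull ℝ (V : Set ℂ)) :
    ∃ o, IsOutcome (Real.pi / 2) (convexHull ℝ (V : Set ℂ)) L o := by
  have hne : V.Nonempty := by
    have := convexHull_nonempty_iff.1 ⟨z, hz⟩
    exact_mod_cast this
  have hnorm : 0 < ‖L.dir‖ := norm_pos_iff.2 L.dir_ne_zero
  set u : ℂ := L.dir / ‖L.dir‖ with hu_def
  have hLu : L.dir = ‖L.dir‖ * u := by
    rw [hu_def, mul_div_cancel₀]
    exact_mod_cast hnorm.ne'
  have hun : ‖u‖ = 1 := by
    rw [hu_def, norm_div, norm_real, norm_norm, div_self hnorm.ne']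
  have hu := dot_self_of_norm hun
  let d : ℝ → ℂ := fun θ => exp ((-θ : ℝ) * I) * u
  have hdn : ∀ θ, ‖d θ‖ = 1 := fun θ => by
    simp only [d, norm_mul, hun, norm_exp_ofReal_mul_I, mul_one]
  have hre : ∀ θ, (d θ).re = Real.cos θ * u.re + Real.sin θ * u.im := fun θ => by
    simp only [d, mul_re, exp_ofReal_mul_I_re, exp_ofReal_mul_I_im, Real.cos_neg, Real.sin_neg]
    ring
  have him : ∀ θ, (d θ).im = Real.cos θ * u.im - Real.sin θ * u.re := fun θ => by
    simp only [d, mul_im, exp_ofReal_mul_I_re, exp_ofReal_mul_I_im, Real.cos_neg, Real.sin_neg]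
    ring
  have hdu : ∀ θ, dot (d θ) u = Real.cos θ := fun θ => by
    simp only [dot, hre, him] at hu ⊢; linear_combination Real.cos θ * hu
  have hcu : ∀ θ, cross (d θ) u = Real.sin θ := fun θ => by
    simp only [dot, cross, hre, him] at hu ⊢; linear_combination Real.sin θ * hu
  let h : ℝ → ℝ := fun θ => V.inf' hne fun x => dot (d θ) x
  let k : ℝ → ℝ := fun θ => V.inf' hne fun x => cross (d θ) x
  have hh : Continuous h := Continuous.finset_inf'_apply hne fun x _ => by
    simp only [dot, hre, him]; fun_prop
  have hk : Continuous k := Continuous.finset_inf'_apply hne fun x _ => by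
    simp only [cross, hre, him]; fun_prop
  let f : ℝ → ℝ := fun θ => -h θ * Real.sin θ + k θ * Real.cos θ - cross u z
  have hf : Continuous f := by fun_prop
  have hle : ∀ θ, ∀ x ∈ V, h θ ≤ dot (d θ) x := fun θ x hx => Finset.inf'_le _ hx
  have kle : ∀ θ, ∀ x ∈ V, k θ ≤ cross (d θ) x := fun θ x hx => Finset.inf'_le _ hx
  have f0 : f 0 ≤ 0 := by
    have := le_cross_of_mem_convexHull (kle 0) hz
    simp only [cross, hre, him] at this
    simp only [f, cross, Real.sin_zero, Real.cos_zero] at *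
    linarith
  have f1 : 0 ≤ f (Real.pi / 2) := by
    have := le_dot_of_mem_convexHull (hle (Real.pi / 2)) hz
    simp only [dot, hre, him, Real.sin_pi_div_two, Real.cos_pi_div_two] at this
    simp only [f, cross, Real.sin_pi_div_two, Real.cos_pi_div_two]
    linarith
  obtain ⟨θ, ⟨hθ0, hθ1⟩, hθ⟩ := intermediate_value_Icc (by positivity : (0 : ℝ) ≤ Real.pi / 2)
    hf.continuousOn ⟨f0, f1⟩
  have hd := dot_self_of_norm (hdn θ)
  set e := d θ
  let q : ℂ := (h θ : ℂ) * e + (k θ : ℂ) * (I * e)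
  have hdq : dot e q = h θ := dot_combo hd _ _
  have hcq : cross e q = k θ := cross_combo hd _ _
  have dsub : ∀ x y, dot e (x - y) = dot e x - dot e y := by
    intro x y; simp only [dot, sub_re, sub_im]; ring
  have csub : ∀ x y, cross e (x - y) = cross e x - cross e y := by
    intro x y; simp only [cross, sub_re, sub_im]; ring
  have hin : ∀ x ∈ V, x ∈ convexHull ℝ (V : Set ℂ) := fun x hx => subset_convexHull _ _ hx
  have hO : ∀ x ∈ convexHull ℝ (V : Set ℂ), 0 ≤ dot e (x - q) ∧ 0 ≤ cross e (x - q) := by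
    intro x hx
    rw [dsub, csub, hdq, hcq]
    exact ⟨sub_nonneg.2 (le_dot_of_mem_convexHull (hle θ) hx),
      sub_nonneg.2 (le_cross_of_mem_convexHull (kle θ) hx)⟩
  let W : Wedge := ⟨q, e, hdn θ⟩
  -- the apex is on `L`, behind `z`
  have hline : cross u (z - q) = 0 := by
    rw [cross_frame hd, dsub, csub, hdq, hcq, hdu, hcu]
    have e1 : cross u z = Real.cos θ * cross e z - Real.sin θ * dot e z := by
      rw [cross_frame hd, hdu, hcu]
    change -h θ * Real.sin θ + k θ * Real.cos θ - cross u z = 0 at hθ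
    rw [e1] at hθ
    linarith
  have hzq : z - q = (dot u (z - q) : ℂ) * u := by
    have := eq_frame hu (z - q)
    rwa [hline, ofReal_zero, zero_mul, add_zero] at this
  set t := dot u (z - q)
  have ht : 0 ≤ t := by
    by_contra! hneg
    have h1 := hO z hz
    rw [hzq, show dot e (t * u) = t * dot e u by simp [dot]; ring,
      show cross e (t * u) = t * cross e u by simp [cross]; ring, hdu, hcu] at h1
    have hc := Real.cos_nonneg_of_neg_pi_div_two_le_of_le (by linarith) hθ1
    have hs := Real.sin_nonneg_of_nonneg_of_le_pi hθ0 (by linarith)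
    have hsq := Real.sin_sq_add_cos_sq θ
    have c0 : Real.cos θ = 0 := by nlinarith
    have s0 : Real.sin θ = 0 := by nlinarith
    rw [c0, s0] at hsq
    norm_num at hsq
  have hcompact : IsCompact (convexHull ℝ (V : Set ℂ)) := V.finite_toSet.isCompact_convexHull ℝ
  have cl₁ : IsClosed W.arm₁ := by
    have : W.arm₁ = {x | 0 ≤ dot e (x - q) ∧ cross e (x - q) = 0} :=
      Set.ext fun x => W.mem_arm₁_iff x
    rw [this]
    exact (isClosed_le continuous_const ((continuous_dot e).comp (by fun_prop))).inter
      (isClosed_eq ((continuous_cross e).comp (by fun_prop)) continuous_const)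
  have cl₂ : IsClosed (W.arm₂ (Real.pi / 2)) := by
    have : W.arm₂ (Real.pi / 2) = {x | dot e (x - q) = 0 ∧ 0 ≤ cross e (x - q)} :=
      Set.ext fun x => W.mem_arm₂_iff x
    rw [this]
    exact (isClosed_eq ((continuous_dot e).comp (by fun_prop)) continuous_const).inter
      (isClosed_le continuous_const ((continuous_cross e).comp (by fun_prop)))
  have n₁ : (convexHull ℝ (V : Set ℂ) ∩ W.arm₁).Nonempty := by
    obtain ⟨x, hx, hxk⟩ := Finset.exists_mem_eq_inf' hne fun x => cross e x
    refine ⟨x, hin x hx, (W.mem_arm₁_iff x).2 ⟨(hO x (hin x hx)).1, ?_⟩⟩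
    change cross e (x - q) = 0
    rw [csub, hcq, ← hxk]; exact sub_self _
  have n₂ : (convexHull ℝ (V : Set ℂ) ∩ W.arm₂ (Real.pi / 2)).Nonempty := by
    obtain ⟨x, hx, hxk⟩ := Finset.exists_mem_eq_inf' hne fun x => dot e x
    refine ⟨x, hin x hx, (W.mem_arm₂_iff x).2 ⟨?_, (hO x (hin x hx)).2⟩⟩
    change dot e (x - q) = 0
    rw [dsub, hdq, ← hxk]; exact sub_self _
  obtain ⟨p₁, hp₁⟩ := exists_isClosestIn (hcompact.inter_right cl₁) n₁ q
  obtain ⟨p₂, hp₂⟩ := exists_isClosestIn (hcompact.inter_right cl₂) n₂ q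
  refine ⟨⟨W, p₁, p₂⟩, ⟨⟨fun x hx => (W.mem_carrier_iff x).2 (hO x hx), n₁, n₂⟩, ?_, ?_⟩, hp₁, hp₂⟩
  · obtain ⟨r, hr⟩ := hzL
    refine ⟨r - t / ‖L.dir‖, ?_⟩
    change q = _
    have hn : (‖L.dir‖ : ℂ) ≠ 0 := by exact_mod_cast hnorm.ne'
    have e1 : q = z - t * u := by rw [← hzq]; ring
    rw [e1, hr, hu_def]
    push_cast
    field_simp
    ring
  · refine ⟨t / ‖L.dir‖, by positivity, ?_⟩
    change q + _ ∈ _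
    have hn : (‖L.dir‖ : ℂ) ≠ 0 := by exact_mod_cast hnorm.ne'
    have e1 : q + ((t / ‖L.dir‖ : ℝ) : ℂ) * L.dir = z := by
      have : ((t / ‖L.dir‖ : ℝ) : ℂ) * L.dir = t * u := by
        rw [hu_def]; push_cast; field_simp
      rw [this, ← hzq]; ring
    rw [e1]; exact hz

/-! ### The vertex set of the polygon -/

/-- The vertices of a polygon as a finite set. -/
noncomputable def vertexSet {n : ℕ} (P : Polygon ℂ n) : Finset ℂ := Finset.univ.image P.vertices

lemma mem_vertexSet {n : ℕ} {P : Polygon ℂ n} {x : ℂ} : x ∈ vertexSet P ↔ ∃ i, P i = x := by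
  simp [vertexSet]

lemma coe_vertexSet {n : ℕ} (P : Polygon ℂ n) : (vertexSet P : Set ℂ) = Set.range P.vertices := by
  simp [vertexSet]

lemma card_vertexSet_le {n : ℕ} (P : Polygon ℂ n) : (vertexSet P).card ≤ n := by
  have := Finset.card_image_le (s := Finset.univ) (f := P.vertices)
  simpa [vertexSet] using this

lemma IsConvexPolygon.sub_one_ne {n : ℕ} [NeZero n] {P : Polygon ℂ n} (hP : IsConvexPolygon P)
    (i : Fin n) : i - 1 ≠ i + 1 ∧ i - 1 ≠ i := by
  have hn := hP.1
  have h1 : ((1 : Fin n) : ℕ) = 1 := by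
    rw [Fin.val_one', Nat.mod_eq_of_lt (by omega)]
  constructor
  · intro h
    have h2 : (1 : Fin n) + 1 = 0 := by
      have : i + (1 + 1) = i + 0 := by rw [← add_assoc, ← h, sub_add_cancel, add_zero]
      exact add_left_cancel this
    have := congrArg Fin.val h2
    rw [Fin.val_add, h1, Nat.mod_eq_of_lt (by omega)] at this
    simp at this
  · intro h
    have h2 : (1 : Fin n) = 0 := by simpa using h
    have := congrArg Fin.val h2
    rw [h1] at this
    simp at this

lemma IsConvexPolygon.obtuseVertexSet {n : ℕ} [NeZero n] {P : Polygon ℂ n}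
    (hP : IsConvexPolygon P) (hangle : ∀ i, Real.pi / 2 < internalAngle P i) :
    ObtuseVertexSet (vertexSet P) where
  extreme := by
    intro v hv
    obtain ⟨i, rfl⟩ := mem_vertexSet.1 hv
    -- a line through the vertex parallel to the diagonal joining its neighbours
    refine ⟨P (i + 1) - P (i - 1), fun x hx hxi => ?_⟩
    obtain ⟨j, rfl⟩ := mem_vertexSet.1 hx
    have hji : j ≠ i := fun h => hxi (by rw [h])
    have e : cross (P (i + 1) - P (i - 1)) (P j - P i) = cross (P (i + 1) - P i) (P j - P i)
        + cross (P i - P (i - 1)) (P j - P (i - 1)) := by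
      simp only [cross, sub_re, sub_im]; ring
    rw [e]
    have h1 := hP.2 i j hji
    have h2 := hP.2 (i - 1) j
    rw [sub_add_cancel] at h2
    by_cases ha : j = i + 1
    · subst ha
      rw [cross_self, zero_add]
      exact h2 (hP.sub_one_ne i).1.symm hji
    · by_cases hb : j = i - 1
      · subst hb
        rw [sub_self (P (i - 1)), show cross (P i - P (i - 1)) 0 = 0 by simp [cross], add_zero]
        exact h1 ha
      · exact add_pos (h1 ha) (h2 hb hji)
  obtuse := by
    intro v hv
    obtain ⟨i, rfl⟩ := mem_vertexSet.1 hv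
    refine ⟨P (i + 1), mem_vertexSet.2 ⟨_, rfl⟩, P (i - 1), mem_vertexSet.2 ⟨_, rfl⟩, ?_,
      (hP.2 i (i - 1) (hP.sub_one_ne i).2 (hP.sub_one_ne i).1).ne'⟩
    by_contra! h
    refine not_le.2 (hangle i) ?_
    rw [internalAngle, EuclideanGeometry.angle, InnerProductGeometry.angle,
      Real.arccos_le_pi_div_two]
    apply div_nonneg _ (by positivity)
    rw [Complex.inner]
    simp only [dot, vsub_eq_sub, mul_re, conj_re, conj_im] at h ⊢
    linarith

/-! ### Confirmed vertices and progress of the loop -/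

/-- The invariant of the polygon `Q`: its vertices are vertices of the hidden polygon, and a
confirmed vertex starts an edge of the hidden polygon that ends in a vertex of `Q`. -/
structure Sound (V : Finset ℂ) (Q : FlaggedPolygon) : Prop where
  sub : Q.verts ⊆ V
  edge : ∀ u ∈ Q.verts, Q.flag u = true →
    ∃ w ∈ Q.verts, w ≠ u ∧ ∀ x ∈ V, 0 ≤ cross (w - u) (x - u)

/-- The number of vertices of `Q` plus the number of confirmed ones. -/
def score (Q : FlaggedPolygon) : ℕ := Q.verts.card + (Q.verts.filter fun u => Q.flag u = true).card

lemma Sound.score_le {Q : FlaggedPolygon} (h : Sound V Q) : score Q ≤ 2 * V.card := by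
  have h1 := Finset.card_le_card h.sub
  have h2 := Finset.card_filter_le Q.verts fun u => Q.flag u = true
  unfold score
  omega

lemma Sound.ofVerts {S : Finset ℂ} (h : S ⊆ V) : Sound V (.ofVerts S) :=
  ⟨h, fun u _ hf => by simp [FlaggedPolygon.ofVerts] at hf⟩

lemma score_ofVerts (S : Finset ℂ) : score (.ofVerts S) = S.card := by
  simp [score, FlaggedPolygon.ofVerts]

lemma Sound.add {Q : FlaggedPolygon} (h : Sound V Q) {x : ℂ} (hx : x ∈ V) :
    Sound V (Q.add x) where
  sub := Finset.insert_subset hx h.sub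
  edge := by
    intro u hu hf
    have hux : u ≠ x := by
      rintro rfl
      simp [FlaggedPolygon.add] at hf
    have hu' : u ∈ Q.verts := (Finset.mem_insert.1 hu).resolve_left hux
    have hf' : Q.flag u = true := by
      simpa [FlaggedPolygon.add, Function.update_of_ne hux] using hf
    obtain ⟨w, hw, h'⟩ := h.edge u hu' hf'
    exact ⟨w, Finset.mem_insert_of_mem hw, h'⟩

lemma score_add {Q : FlaggedPolygon} {x : ℂ} (hx : x ∉ Q.verts) :
    score (Q.add x) = score Q + 1 := by
  have : ((Q.add x).verts.filter fun u => (Q.add x).flag u = true)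
      = Q.verts.filter fun u => Q.flag u = true := by
    ext u
    by_cases hux : u = x
    · subst hux; simp only [Finset.mem_filter]; simp [FlaggedPolygon.add, hx]
    · simp only [Finset.mem_filter]; simp [FlaggedPolygon.add, hux]
  unfold score
  rw [this]
  simp only [FlaggedPolygon.add, Finset.card_insert_of_notMem hx]
  omega

lemma Sound.addIfNew {Q : FlaggedPolygon} (h : Sound V Q) {x : ℂ} (hx : x ∈ V) :
    Sound V (Q.addIfNew x) := by
  unfold FlaggedPolygon.addIfNew
  split_ifs
  · exact h
  · exact h.add hx

lemma le_score_addIfNew (Q : FlaggedPolygon) (x : ℂ) : score Q ≤ score (Q.addIfNew x) := by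
  unfold FlaggedPolygon.addIfNew
  split_ifs with h
  · exact le_rfl
  · rw [score_add h]; omega

lemma subset_addIfNew (Q : FlaggedPolygon) (x : ℂ) : Q.verts ⊆ (Q.addIfNew x).verts := by
  unfold FlaggedPolygon.addIfNew
  split_ifs
  · exact subset_rfl
  · exact Finset.subset_insert _ _

lemma Sound.confirm {Q : FlaggedPolygon} (h : Sound V Q) {u w : ℂ} (hw : w ∈ Q.verts)
    (hwu : w ≠ u) (he : ∀ x ∈ V, 0 ≤ cross (w - u) (x - u)) : Sound V (Q.confirm u) where
  sub := h.sub
  edge := by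
    intro y hy hf
    by_cases hyu : y = u
    · subst hyu; exact ⟨w, hw, hwu, he⟩
    · exact h.edge y hy (by simpa [FlaggedPolygon.confirm, Function.update_of_ne hyu] using hf)

lemma score_confirm {Q : FlaggedPolygon} {u : ℂ} (hu : u ∈ Q.verts) (hf : Q.flag u = false) :
    score (Q.confirm u) = score Q + 1 := by
  have : ((Q.confirm u).verts.filter fun x => (Q.confirm u).flag x = true)
      = insert u (Q.verts.filter fun x => Q.flag x = true) := by
    ext x
    by_cases hux : x = u
    · subst hux; simp only [Finset.mem_filter]; simp [FlaggedPolygon.confirm, hu]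
    · simp only [Finset.mem_filter, Finset.mem_insert]; simp [FlaggedPolygon.confirm, hux]
  unfold score
  rw [this, Finset.card_insert_of_notMem (by simp [hf])]
  simp only [FlaggedPolygon.confirm]
  omega

/-- Every vertex of `Q` has a successor: the first vertex met by a ray that turns about it,
starting from a line on one side of which the polygon lies. -/
lemma ObtuseVertexSet.exists_isCCWSucc (hV : ObtuseVertexSet V) {Q : FlaggedPolygon}
    (hQ : Q.verts ⊆ V) {u : ℂ} (hu : u ∈ Q.verts) (hc : 2 ≤ Q.verts.card) :
    ∃ v, Q.IsCCWSucc u v := by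
  obtain ⟨f, hf⟩ := hV.extreme u (hQ hu)
  have hne : (Q.verts.erase u).Nonempty := by
    rw [← Finset.card_pos, Finset.card_erase_of_mem hu]; omega
  obtain ⟨v, hv, hmax⟩ := (Q.verts.erase u).exists_max_image
    (fun x => dot f (x - u) / cross f (x - u)) hne
  obtain ⟨hvu, hv⟩ := Finset.mem_erase.1 hv
  refine ⟨v, hu, hv, hvu.symm, fun w hw hwu hwv => ?_⟩
  refine lt_of_le_of_ne ?_
    (hV.cross_ne_zero (hQ hu) (hQ hv) (hQ hw) hvu.symm hwu.symm hwv.symm).symm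
  have hcv := hf v (hQ hv) hvu
  have hcw := hf w (hQ hw) hwu
  have h := hmax w (Finset.mem_erase.2 ⟨hwu, hw⟩)
  rw [div_le_div_iff₀ hcw hcv] at h
  have hf0 : f ≠ 0 := by
    rintro rfl
    simp [cross] at hcv
  have e : dot f f * cross (v - u) (w - u) = dot f (v - u) * cross f (w - u)
      - cross f (v - u) * dot f (w - u) := by simp only [dot, cross]; ring
  refine nonneg_of_mul_nonneg_right ?_ (dot_self_pos hf0)
  rw [e]; linarith

/-- When all vertices of `Q` are confirmed, `Q` is closed under passing to the next vertex of the
polygon. -/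
lemma Sound.verts_eq {n : ℕ} [NeZero n] {P : Polygon ℂ n} (hP : IsConvexPolygon P)
    {Q : FlaggedPolygon} (h : Sound (vertexSet P) Q) (hne : Q.verts.Nonempty) (hF : Q.F = 0) :
    Q.verts = vertexSet P := by
  have hflag : ∀ u ∈ Q.verts, Q.flag u = true := by
    intro u hu
    rw [FlaggedPolygon.F, Finset.card_eq_zero, Finset.filter_eq_empty_iff] at hF
    simpa using hF hu
  have hstep : ∀ i, P i ∈ Q.verts → P (i + 1) ∈ Q.verts := by
    intro i hi
    obtain ⟨w, hw, hwi, he⟩ := h.edge _ hi (hflag _ hi)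
    obtain ⟨j, rfl⟩ := mem_vertexSet.1 (h.sub hw)
    by_cases hj : j = i + 1
    · rwa [← hj]
    · exfalso
      have h1 := hP.2 i j (fun h => hwi (by rw [h])) hj
      have h2 := he (P (i + 1)) (mem_vertexSet.2 ⟨_, rfl⟩)
      rw [cross_comm] at h2
      linarith
  obtain ⟨x, hx⟩ := hne
  obtain ⟨i, rfl⟩ := mem_vertexSet.1 (h.sub hx)
  have hall : ∀ m : ℕ, P (i + Fin.ofNat n m) ∈ Q.verts := by
    intro m
    induction m with
    | zero => simpa [Fin.ofNat] using hx
    | succ m ih =>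
      have := hstep _ ih
      rw [add_assoc] at this
      convert this using 3
      apply Fin.ext
      simp [Fin.ofNat, Fin.val_add]
  refine subset_antisymm h.sub fun y hy => ?_
  obtain ⟨j, rfl⟩ := mem_vertexSet.1 hy
  have := hall (j - i).val
  simpa using this

/-! ### The invariant of a run -/

lemma Touch.ne {d p₁ p₂ : ℂ} (h : Touch V d p₁ p₂) : p₁ ≠ p₂ := by
  rintro rfl
  have := h.dot_pos
  simp [dot] at this

lemma score_add_confirm {Q : FlaggedPolygon} {x u : ℂ} (hx : x ∉ Q.verts) (hu : u ∈ Q.verts)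
    (hf : Q.flag u = false) : score ((Q.add x).confirm u) = score Q + 2 := by
  rw [score_confirm (Finset.mem_insert_of_mem hu), score_add hx]
  have : u ≠ x := fun h => hx (h ▸ hu)
  simpa [FlaggedPolygon.add, Function.update_of_ne this] using hf

lemma score_add_add {Q : FlaggedPolygon} {x y : ℂ} (hx : x ∉ Q.verts) (hy : y ∉ Q.verts)
    (hxy : x ≠ y) : score ((Q.add x).add y) = score Q + 2 := by
  rw [score_add, score_add hx]
  simp [FlaggedPolygon.add, hy, hxy.symm]

lemma card_le_add (Q : FlaggedPolygon) (x : ℂ) : Q.verts.card ≤ (Q.add x).verts.card :=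
  Finset.card_le_card (Finset.subset_insert _ _)

lemma card_four {a b c d : ℂ} (hab : a ≠ b) (hac : a ≠ c) (had : a ≠ d) (hbc : b ≠ c)
    (hbd : b ≠ d) (hcd : c ≠ d) : ({a, b, c, d} : Finset ℂ).card = 4 := by
  rw [Finset.card_insert_of_notMem, Finset.card_insert_of_notMem, Finset.card_pair hcd] <;>
    simp [*]

/-- What holds in each control state after `k` probes.  In the loop, the number of probes is
bounded by the score minus `3`. -/
def Invariant (V : Finset ℂ) (k : ℕ) : State → Prop
  | .start => k = 0
  | .afterFirst o => k = 1 ∧ ∃ d, Touch V d o.p₁ o.p₂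
  | .needThird v₁ v₂ v₄ => k = 2 ∧ ∃ d d', Touch V d v₁ v₂ ∧ Touch V d' v₄ v₁ ∧
      Along V d' v₄ v₁ v₁ v₂
  | .hitCase1 _ _ v₁ v₂ v₃ v₄ Q => k = 2 ∧ Q = .ofVerts {v₁, v₂, v₃, v₄} ∧
      ∃ d d', Touch V d v₁ v₂ ∧ Touch V d' v₃ v₄ ∧ Along V d' v₃ v₄ v₁ v₂ ∧ v₄ ≠ v₁
  | .hitCase2 v₃ v₄ Q => k = 3 ∧ ∃ v₁ v₂ v d d' d'', Touch V d v₁ v₂ ∧ Touch V d' v₄ v₁ ∧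
      Along V d' v₄ v₁ v₁ v₂ ∧ Touch V d'' v₃ v ∧ Along V d'' v₃ v v₄ v₂ ∧ Sound V Q ∧
      Q.verts ⊆ {v₁, v₂, v₃, v₄, v} ∧ v₃ ∈ Q.verts ∧ v₄ ∈ Q.verts ∧ Q.flag v₄ = false ∧
      3 ≤ Q.verts.card ∧ 5 ≤ score Q
  | .loop Q => Sound V Q ∧ 3 ≤ Q.verts.card ∧ k + 3 ≤ score Q

/-- The vertices `v₁, v₂, v₃, v₄` of the first case are distinct. -/
lemma ObtuseVertexSet.distinct_case₁ (hV : ObtuseVertexSet V) {d d' v₁ v₂ v₃ v₄ : ℂ}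
    (h₁ : Touch V d v₁ v₂) (h₂ : Touch V d' v₃ v₄) (hA : Along V d' v₃ v₄ v₁ v₂)
    (hne : v₄ ≠ v₁) : v₁ ≠ v₂ ∧ v₁ ≠ v₃ ∧ v₁ ≠ v₄ ∧ v₂ ≠ v₃ ∧ v₂ ≠ v₄ ∧ v₃ ≠ v₄ := by
  have hr := hV.second_right h₁ hA
  have hl : 0 < cross (v₂ - v₁) (v₄ - v₁) := by
    rcases hA.left with h | h
    · exact h.1
    · exact absurd h.1 hne
  refine ⟨h₁.ne, ?_, hne.symm, ?_, ?_, h₂.ne⟩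
  · rintro rfl; simp [cross] at hr
  · rintro rfl; rw [cross_self] at hr; exact lt_irrefl _ hr
  · rintro rfl; rw [cross_self] at hl; exact lt_irrefl _ hl

lemma invariant_afterSecond {o o' : Outcome}
    {d d' : ℂ} (h₁ : Touch V d o.p₁ o.p₂) (h₂ : Touch V d' o'.p₁ o'.p₂)
    (hA : Along V d' o'.p₁ o'.p₂ o.p₁ o.p₂) : Invariant V 2 (afterSecond o o') := by
  unfold afterSecond
  split_ifs with h
  · rw [h] at h₂ hA
    exact ⟨rfl, d, d', h₁, h₂, hA⟩
  · exact ⟨rfl, rfl, d, d', h₁, h₂, hA, h⟩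

/-- The second probe showed that `v₂ v₁` is an edge, which is why `v₂` is confirmed. -/
lemma ObtuseVertexSet.invariant_afterThird (hV : ObtuseVertexSet V) {v₁ v₂ v₄ : ℂ} {o : Outcome}
    {d d' d'' : ℂ} (h₁ : Touch V d v₁ v₂) (h₂ : Touch V d' v₄ v₁) (hA : Along V d' v₄ v₁ v₁ v₂)
    (h₃ : Touch V d'' o.p₁ o.p₂) (hB : Along V d'' o.p₁ o.p₂ v₄ v₂) :
    Invariant V 3 (afterThird v₁ v₂ v₄ o) := by
  obtain ⟨hr₃, hlv, -, -⟩ := hV.third h₁ h₂ hA h₃ hB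
  have hr := hV.second_right h₁ hA
  have hl : 0 < cross (v₂ - v₄) (v₁ - v₄) := by
    have : cross (v₂ - v₄) (v₁ - v₄) = -cross (v₂ - v₁) (v₄ - v₁) := by
      simp only [cross, sub_re, sub_im]; ring
    linarith
  have n12 := h₁.ne
  have n41 := h₂.ne
  have n24 : v₂ ≠ v₄ := by
    rintro rfl; rw [cross_self] at hr; exact lt_irrefl _ hr
  have n13 : v₁ ≠ o.p₁ := by
    intro h; rw [← h] at hr₃; linarith
  have n23 : v₂ ≠ o.p₁ := by
    intro h; rw [← h, cross_self] at hr₃; exact lt_irrefl _ hr₃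
  have n34 : o.p₁ ≠ v₄ := by
    intro h; rw [h] at hr₃; simp [cross] at hr₃
  have nv2 : o.p₂ ≠ v₂ := by
    intro h; rw [h, cross_self] at hlv; exact lt_irrefl _ hlv
  have nv4 : o.p₂ ≠ v₄ := by
    intro h; rw [h] at hlv; simp [cross] at hlv
  have nv3 : o.p₂ ≠ o.p₁ := h₃.ne.symm
  have hcard := card_four n12 n13 n41.symm n23 n24 n34
  set S : Finset ℂ := {v₁, v₂, o.p₁, v₄} with hS
  have hSV : S ⊆ V := by
    intro x hx
    simp only [hS, Finset.mem_insert, Finset.mem_singleton] at hx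
    rcases hx with rfl | rfl | rfl | rfl
    exacts [h₁.mem₁, h₁.mem₂, h₃.mem₁, h₂.mem₁]
  have hedge : ∀ x ∈ V, 0 ≤ cross (v₁ - v₂) (x - v₂) := by
    rcases hA.left with ⟨h, -⟩ | ⟨-, -, h⟩
    · simp [cross] at h
    · intro x hx
      rw [cross_swap]
      linarith [h x hx]
  set Q := (FlaggedPolygon.ofVerts S).confirm v₂ with hQ
  have hQv : Q.verts = S := rfl
  have hsound : Sound V Q := (Sound.ofVerts hSV).confirm (w := v₁)
    (by simp [FlaggedPolygon.ofVerts, hS]) n12 hedge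
  have hscore : score Q = 5 := by
    rw [hQ, score_confirm (by simp [FlaggedPolygon.ofVerts, hS]) rfl, score_ofVerts, hcard]
  have hflag : Q.flag v₄ = false := by
    simp [hQ, FlaggedPolygon.confirm, FlaggedPolygon.ofVerts, Function.update_of_ne n24.symm]
  refine ⟨rfl, v₁, v₂, o.p₂, d, d', d'', h₁, h₂, hA, h₃, hB, ?_⟩
  change Sound V (if o.p₂ = v₁ then Q else Q.add o.p₂) ∧ _
  split_ifs with hv
  · refine ⟨hsound, ?_, ?_, ?_, hflag, by rw [hQv, hcard]; norm_num, hscore.ge⟩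
    · rw [hQv, hS, hv]; intro x; simp only [Finset.mem_insert, Finset.mem_singleton]; tauto
    · change _ ∈ S
      simp [hS]
    · change _ ∈ S
      simp [hS]
  · have hnew : o.p₂ ∉ Q.verts := by simp [hQv, hS, hv, nv2, nv3, nv4]
    refine ⟨hsound.add h₃.mem₂, ?_, ?_, ?_, ?_, ?_, ?_⟩
    · change insert o.p₂ S ⊆ _
      rw [hS]; intro x; simp only [Finset.mem_insert, Finset.mem_singleton]; tauto
    · change _ ∈ insert o.p₂ S
      simp [hS]
    · change _ ∈ insert o.p₂ S
      simp [hS]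
    · simpa [FlaggedPolygon.add, Function.update_of_ne nv4.symm] using hflag
    · have := card_le_add Q o.p₂
      rw [hQv, hcard] at this
      exact le_trans (by norm_num) this
    · rw [score_add hnew, hscore]; norm_num

lemma ObtuseVertexSet.invariant_afterHit31 (hV : ObtuseVertexSet V) {d d' e v₁ v₂ v₃ v₄ : ℂ}
    {o : Outcome} (h₁ : Touch V d v₁ v₂) (h₂ : Touch V d' v₃ v₄) (hA : Along V d' v₃ v₄ v₁ v₂)
    (hne : v₄ ≠ v₁) (h₃ : Touch V e o.p₁ o.p₂) (hE : Along V e o.p₁ o.p₂ v₃ v₁) :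
    Invariant V 3 (afterHit31 v₁ v₃ (.ofVerts {v₁, v₂, v₃, v₄}) o) := by
  obtain ⟨n12, n13, n14, n23, n24, n34⟩ := hV.distinct_case₁ h₁ h₂ hA hne
  obtain ⟨a1, a2, a3, a4, a5, hp₂⟩ := hV.hit31 h₁ h₂ hA hne h₃ hE
  have hcard := card_four n12 n13 n14 n23 n24 n34
  set S : Finset ℂ := {v₁, v₂, v₃, v₄} with hS
  have hSV : S ⊆ V := by
    intro x hx
    simp only [hS, Finset.mem_insert, Finset.mem_singleton] at hx
    rcases hx with rfl | rfl | rfl | rfl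
    exacts [h₁.mem₁, h₁.mem₂, h₂.mem₁, h₂.mem₂]
  have hnew : o.p₁ ∉ (FlaggedPolygon.ofVerts S).verts := by
    simp [FlaggedPolygon.ofVerts, hS, a1, a2, a3, a4]
  have hsound := (Sound.ofVerts hSV).add h₃.mem₁
  have hc := card_le_add (.ofVerts S) o.p₁
  have hc' := card_le_add ((FlaggedPolygon.ofVerts S).add o.p₁) o.p₂
  change S.card ≤ _ at hc
  unfold afterHit31
  rcases hp₂ with ⟨rfl, hedge⟩ | ⟨b1, b2, b3, b4⟩
  · rw [if_pos rfl]
    refine ⟨hsound.confirm (w := o.p₂) ?_ n13.symm hedge, ?_, ?_⟩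
    · simp [FlaggedPolygon.add, FlaggedPolygon.ofVerts, hS]
    · change 3 ≤ ((FlaggedPolygon.ofVerts S).add o.p₁).verts.card
      omega
    · rw [score_add_confirm hnew (by simp [FlaggedPolygon.ofVerts, hS]) rfl, score_ofVerts, hcard]
  · rw [if_neg b3]
    refine ⟨hsound.add h₃.mem₂, by omega, ?_⟩
    rw [score_add_add hnew (by simp [FlaggedPolygon.ofVerts, hS, b1, b2, b3, b4]) a5,
      score_ofVerts, hcard]

lemma ObtuseVertexSet.invariant_afterHit24 (hV : ObtuseVertexSet V) {d d' e v₁ v₂ v₃ v₄ : ℂ}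
    {o : Outcome} (h₁ : Touch V d v₁ v₂) (h₂ : Touch V d' v₃ v₄) (hA : Along V d' v₃ v₄ v₁ v₂)
    (hne : v₄ ≠ v₁) (h₃ : Touch V e o.p₁ o.p₂) (hE : Along V e o.p₁ o.p₂ v₂ v₄) :
    Invariant V 3 (afterHit24 v₂ (.ofVerts {v₁, v₂, v₃, v₄}) o) := by
  obtain ⟨n12, n13, n14, n23, n24, n34⟩ := hV.distinct_case₁ h₁ h₂ hA hne
  obtain ⟨a1, a2, a3, a4, a5, hp₁⟩ := hV.hit24 h₁ h₂ hA hne h₃ hE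
  have hcard := card_four n12 n13 n14 n23 n24 n34
  set S : Finset ℂ := {v₁, v₂, v₃, v₄} with hS
  have hSV : S ⊆ V := by
    intro x hx
    simp only [hS, Finset.mem_insert, Finset.mem_singleton] at hx
    rcases hx with rfl | rfl | rfl | rfl
    exacts [h₁.mem₁, h₁.mem₂, h₂.mem₁, h₂.mem₂]
  have hnew : o.p₂ ∉ (FlaggedPolygon.ofVerts S).verts := by
    simp [FlaggedPolygon.ofVerts, hS, a1, a2, a3, a4]
  have hsound := (Sound.ofVerts hSV).add h₃.mem₂
  have hc := card_le_add (.ofVerts S) o.p₂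
  have hc' := card_le_add ((FlaggedPolygon.ofVerts S).add o.p₂) o.p₁
  change S.card ≤ _ at hc
  unfold afterHit24
  rcases hp₁ with ⟨h, hedge⟩ | ⟨b1, b2, b3, b4⟩
  · rw [if_pos h]
    refine ⟨hsound.confirm (w := v₄) ?_ n24.symm hedge, ?_, ?_⟩
    · simp [FlaggedPolygon.add, FlaggedPolygon.ofVerts, hS]
    · change 3 ≤ ((FlaggedPolygon.ofVerts S).add o.p₂).verts.card
      omega
    · rw [score_add_confirm hnew (by simp [FlaggedPolygon.ofVerts, hS]) rfl, score_ofVerts, hcard]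
  · rw [if_neg b2]
    refine ⟨hsound.add h₃.mem₁, by omega, ?_⟩
    rw [score_add_add hnew (by simp [FlaggedPolygon.ofVerts, hS, b1, b2, b3, b4]) a5,
      score_ofVerts, hcard]

lemma ObtuseVertexSet.invariant_afterHit34 (hV : ObtuseVertexSet V) {v₃ v₄ e : ℂ}
    {Q : FlaggedPolygon} {o : Outcome} (hI : Invariant V 3 (.hitCase2 v₃ v₄ Q))
    (h₄ : Touch V e o.p₁ o.p₂) (hE : Along V e o.p₁ o.p₂ v₃ v₄) :
    Invariant V 4 (afterHit34 v₃ v₄ Q o) := by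
  obtain ⟨-, v₁, v₂, v, d, d', d'', h₁, h₂, hA, h₃, hB, hQ, hsub, hv₃, hv₄, hf, hc, hs⟩ := hI
  obtain ⟨⟨a1, a2, a3, a4, a5⟩, a6, hp₂⟩ := hV.hit34 h₁ h₂ hA h₃ hB h₄ hE
  have hnew : o.p₁ ∉ Q.verts := fun h => by
    have := hsub h
    simp [a1, a2, a3, a4, a5] at this
  have hsound := hQ.add h₄.mem₁
  have hc₁ := card_le_add Q o.p₁
  have hc₂ := card_le_add (Q.add o.p₁) o.p₂
  unfold afterHit34
  rcases hp₂ with ⟨h, hedge⟩ | ⟨b1, b2, b3, b4, b5⟩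
  · rw [if_pos h]
    refine ⟨hsound.confirm (w := v₃) (Finset.mem_insert_of_mem hv₃) ?_ hedge, ?_, ?_⟩
    · rintro rfl
      have := hV.third h₁ h₂ hA h₃ hB
      simp [cross] at this
    · change 3 ≤ (Q.add o.p₁).verts.card
      omega
    · rw [score_add_confirm hnew hv₄ hf]; omega
  · rw [if_neg b3]
    refine ⟨hsound.add h₄.mem₂, by omega, ?_⟩
    rw [score_add_add hnew (fun h => by
      have := hsub h
      simp [b1, b2, b3, b4, b5] at this) a6]
    omega

/-- An iteration of the loop finds a new vertex on the right of the edge `uv` of `Q`, or confirms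
that this is an edge of the hidden polygon.  The branch in which the second arm returns `u` is
never taken, since `Q` has a vertex on the left of `uv`. -/
lemma invariant_afterLoop {k : ℕ} {Q : FlaggedPolygon}
    {u v e : ℂ} {o : Outcome} (hI : Invariant V k (.loop Q)) (hf : Q.flag u = false)
    (hs : Q.IsCCWSucc u v) (hT : Touch V e o.p₁ o.p₂) (hE : Along V e o.p₁ o.p₂ u v) :
    Invariant V (k + 1) (afterLoop Q u v o) := by
  obtain ⟨hQ, hc, hk⟩ := hI
  obtain ⟨w, hw, hwn⟩ : ∃ w ∈ Q.verts, w ∉ ({u, v} : Finset ℂ) := by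
    apply Finset.exists_mem_notMem_of_card_lt_card
    exact lt_of_le_of_lt Finset.card_le_two hc
  simp only [Finset.mem_insert, Finset.mem_singleton, not_or] at hwn
  have hl := hE.left_of_mem (hQ.sub hw) (hs.left_of w hw hwn.1 hwn.2)
  have hp₂ : o.p₂ ≠ u := by
    intro h; rw [h] at hl; simp [cross] at hl
  unfold afterLoop
  by_cases hp₁ : o.p₁ = u
  · rw [if_pos hp₁]
    have hedge : ∀ x ∈ V, 0 ≤ cross (v - u) (x - u) := by
      rcases hE.right with ⟨h, -⟩ | ⟨-, -, h⟩
      · rw [hp₁] at h; simp [cross] at h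
      · exact h
    refine ⟨(hQ.confirm hs.right_mem hs.ne.symm hedge).addIfNew hT.mem₂, ?_, ?_⟩
    · exact hc.trans (Finset.card_le_card (subset_addIfNew (Q.confirm u) o.p₂))
    · have h1 := le_score_addIfNew (Q.confirm u) o.p₂
      rw [score_confirm hs.left_mem hf] at h1
      omega
  · rw [if_neg hp₁, if_neg hp₂]
    have hr : cross (v - u) (o.p₁ - u) < 0 := by
      rcases hE.right with ⟨h, -⟩ | ⟨h, -⟩
      · exact h
      · exact absurd h hp₁
    have hnew : o.p₁ ∉ Q.verts := by
      intro h
      by_cases hv : o.p₁ = v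
      · rw [hv, cross_self] at hr; exact lt_irrefl _ hr
      · linarith [hs.left_of _ h hp₁ hv]
    refine ⟨(hQ.add hT.mem₁).addIfNew hT.mem₂, ?_, ?_⟩
    · exact hc.trans ((card_le_add Q o.p₁).trans
        (Finset.card_le_card (subset_addIfNew (Q.add o.p₁) o.p₂)))
    · have h1 := le_score_addIfNew (Q.add o.p₁) o.p₂
      rw [score_add hnew] at h1
      omega

lemma ObtuseVertexSet.invariant_of_run (hV : ObtuseVertexSet V) {p : ℂ} {k : ℕ} {s : State}
    (h : Run (Real.pi / 2) (convexHull ℝ (V : Set ℂ)) p k s) : Invariant V k s := by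
  induction h with
  | start => rfl
  | @probe k s L next o hs hm ho ih =>
    have hT := (hV.touch ho).1
    cases hm with
    | first L hL =>
      cases ih
      exact ⟨rfl, _, hT⟩
    | second o₁ hne =>
      obtain ⟨rfl, d, h₁⟩ := ih
      exact invariant_afterSecond h₁ hT (hV.along hne h₁.mem₁ h₁.mem₂ ho)
    | third v₁ v₂ v₄ hne =>
      obtain ⟨rfl, d, d', h₁, h₂, hA⟩ := ih
      exact hV.invariant_afterThird h₁ h₂ hA hT (hV.along hne h₂.mem₁ h₁.mem₂ ho)
    | hit31 q q' v₁ v₂ v₃ v₄ Q hne =>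
      obtain ⟨rfl, rfl, d, d', h₁, h₂, hA, hn⟩ := ih
      exact hV.invariant_afterHit31 h₁ h₂ hA hn hT (hV.along hne h₂.mem₁ h₁.mem₁ ho)
    | hit24 q q' v₁ v₂ v₃ v₄ Q hne =>
      obtain ⟨rfl, rfl, d, d', h₁, h₂, hA, hn⟩ := ih
      exact hV.invariant_afterHit24 h₁ h₂ hA hn hT (hV.along hne h₁.mem₂ h₂.mem₂ ho)
    | hit34 v₃ v₄ Q hne =>
      obtain ⟨rfl, -⟩ := id ih
      have hi := ih
      obtain ⟨-, v₁, v₂, v, d, d', d'', h₁, h₂, hA, h₃, hB, -⟩ := ih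
      exact hV.invariant_afterHit34 hi hT (hV.along hne h₃.mem₁ h₂.mem₁ ho)
    | iterate Q u v hu hv =>
      exact invariant_afterLoop ih hu hv hT
        (hV.along hv.ne (ih.1.sub hv.left_mem) (ih.1.sub hv.right_mem) ho)

lemma DirectedLine.left_mem_through {a b : ℂ} (h : a ≠ b) :
    a ∈ (DirectedLine.through a b h).carrier := ⟨0, by simp [DirectedLine.through]⟩

/-- Every move of the algorithm is made along a line that meets the polygon. -/
lemma Invariant.exists_isOutcome {p : ℂ} (hp : p ∈ convexHull ℝ (V : Set ℂ)) {k : ℕ} {s : State}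
    (hI : Invariant V k s) {L : DirectedLine} {next : Outcome → State} (hm : Move p s L next) :
    ∃ o, IsOutcome (Real.pi / 2) (convexHull ℝ (V : Set ℂ)) L o := by
  have hin : ∀ {a b : ℂ} (h : a ≠ b), a ∈ V → ∃ o, IsOutcome (Real.pi / 2)
      (convexHull ℝ (V : Set ℂ)) (.through a b h) o := fun h ha =>
    WedgeProbing.exists_isOutcome _ (DirectedLine.left_mem_through h) (subset_convexHull _ _ ha)
  cases hm with
  | first L hL => exact WedgeProbing.exists_isOutcome L hL hp
  | second o₁ hne =>
    obtain ⟨-, d, h₁⟩ := hI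
    exact hin hne h₁.mem₁
  | third v₁ v₂ v₄ hne =>
    obtain ⟨-, d, d', h₁, h₂, hA⟩ := hI
    exact hin hne h₂.mem₁
  | hit31 q q' v₁ v₂ v₃ v₄ Q hne =>
    obtain ⟨-, -, d, d', h₁, h₂, hA, hn⟩ := hI
    exact hin hne h₂.mem₁
  | hit24 q q' v₁ v₂ v₃ v₄ Q hne =>
    obtain ⟨-, -, d, d', h₁, h₂, hA, hn⟩ := hI
    exact hin hne h₁.mem₂
  | hit34 v₃ v₄ Q hne =>
    obtain ⟨-, v₁, v₂, v, d, d', d'', h₁, h₂, hA, h₃, hB, -⟩ := hI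
    exact hin hne h₃.mem₁
  | iterate Q u v hu hv => exact hin hv.ne (hI.1.sub hv.left_mem)

lemma ObtuseVertexSet.exists_move (hV : ObtuseVertexSet V) (p : ℂ) {k : ℕ} {s : State}
    (hI : Invariant V k s) (hs : ¬ ∃ Q, HaltedWith s Q) : ∃ L next, Move p s L next := by
  cases s with
  | start => exact ⟨⟨p, 1, one_ne_zero⟩, _, .first _ ⟨0, by simp⟩⟩
  | afterFirst o =>
    obtain ⟨-, d, h₁⟩ := hI
    exact ⟨_, _, .second o h₁.ne⟩
  | needThird v₁ v₂ v₄ =>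
    obtain ⟨-, d, d', h₁, h₂, hA⟩ := hI
    refine ⟨_, _, .third v₁ v₂ v₄ ?_⟩
    rintro rfl
    have := hV.second_right h₁ hA
    rw [cross_self] at this
    exact lt_irrefl _ this
  | hitCase1 q q' v₁ v₂ v₃ v₄ Q =>
    obtain ⟨-, -, d, d', h₁, h₂, hA, hn⟩ := hI
    obtain ⟨-, n13, -, -, n24, -⟩ := hV.distinct_case₁ h₁ h₂ hA hn
    rcases lt_or_ge (EuclideanGeometry.angle v₂ v₃ q') (EuclideanGeometry.angle q v₂ v₃) with h | h
    · exact ⟨_, _, .hit31 q q' v₁ v₂ v₃ v₄ Q n13.symm h⟩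
    · exact ⟨_, _, .hit24 q q' v₁ v₂ v₃ v₄ Q n24 h⟩
  | hitCase2 v₃ v₄ Q =>
    obtain ⟨-, v₁, v₂, v, d, d', d'', h₁, h₂, hA, h₃, hB, -⟩ := hI
    refine ⟨_, _, .hit34 v₃ v₄ Q ?_⟩
    rintro rfl
    have := hV.third h₁ h₂ hA h₃ hB
    simp [cross] at this
  | loop Q =>
    have hF : Q.F ≠ 0 := fun h => hs ⟨Q, rfl, h⟩
    rw [FlaggedPolygon.F, Finset.card_ne_zero] at hF
    obtain ⟨u, hu⟩ := hF
    rw [Finset.mem_filter] at hu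
    obtain ⟨v, hv⟩ := hV.exists_isCCWSucc hI.1.sub hu.1 (by have := hI.2.1; omega)
    exact ⟨_, _, .iterate Q u v hu.2 hv⟩

lemma Invariant.le {n k : ℕ} (hn : 3 ≤ n) (hV : V.card ≤ n) {s : State} (hI : Invariant V k s) :
    k ≤ 2 * n - 3 := by
  cases s with
  | start => simp only [Invariant] at hI; omega
  | afterFirst o => have := hI.1; omega
  | needThird v₁ v₂ v₄ => have := hI.1; omega
  | hitCase1 q q' v₁ v₂ v₃ v₄ Q => have := hI.1; omega
  | hitCase2 v₃ v₄ Q => have := hI.1; omega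
  | loop Q =>
    have h1 := hI.1.score_le
    have h2 := hI.2.2
    omega

end WedgeProbing

theorem mainTheorem3 {n : ℕ} [NeZero n] (P : Polygon ℂ n)
    (hP : WedgeProbing.IsConvexPolygon P)
    (hangle : ∀ i : Fin n, Real.pi / 2 < WedgeProbing.internalAngle P i)
    (p : ℂ) (hp : p ∈ WedgeProbing.region P)
    (k : ℕ) (s : WedgeProbing.State)
    (hrun : WedgeProbing.Run (Real.pi / 2) (WedgeProbing.region P) p k s) :
    -- no run makes more than `2n - 3` probes
    k ≤ 2 * n - 3 ∧
    -- a run never gets stuck before it halts, and each of its probes has an outcome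
    ((¬ ∃ Q, WedgeProbing.HaltedWith s Q) → ∃ L next, WedgeProbing.Move p s L next) ∧
    (∀ L next, WedgeProbing.Move p s L next →
      ∃ o, WedgeProbing.IsOutcome (Real.pi / 2) (WedgeProbing.region P) L o) ∧
    -- when it halts, the polygon has been reconstructed
    (∀ Q, WedgeProbing.HaltedWith s Q →
      (Q.verts : Set ℂ) = Set.range P.vertices ∧
        convexHull ℝ (Q.verts : Set ℂ) = WedgeProbing.region P) := by
  have hV := hP.obtuseVertexSet hangle
  have hO : WedgeProbing.region P = convexHull ℝ (WedgeProbing.vertexSet P : Set ℂ) := by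
    rw [WedgeProbing.coe_vertexSet, WedgeProbing.region]
  rw [hO] at hp hrun ⊢
  have hI := hV.invariant_of_run hrun
  refine ⟨hI.le hP.1 (WedgeProbing.card_vertexSet_le P), hV.exists_move p hI,
    fun L next hm => hI.exists_isOutcome hp hm, ?_⟩
  rintro Q ⟨rfl, hF⟩
  have hne : Q.verts.Nonempty := by
    rw [← Finset.card_pos]
    have := hI.2.1
    omega
  have hQ := hI.1.verts_eq hP hne hF
  rw [hQ]
  exact ⟨WedgeProbing.coe_vertexSet P, rfl⟩
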